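/- **Setting.** *Primitives.* Let $DS=(\mathrm{gen},\mathrm{sign},\mathrm{verify})$ be a signature scheme and $AE=(\mathrm{gen},\mathrm{enc},\mathrm{dec})$ a symmetric authenticated encryption scheme, both consisting of PPT algorithms, with deterministic verification and decryption and perfect correctness; let $(\mathbb G_d)_d$ be a family of groups with an encoding of the elements for which membership and powers are computable in polynomial time. (No security property of these primitives is needed.) An algorithm is PPT if, on every input and for all its random choices, its number of steps is at most a fixed polynomial in the bit length of its input; algorithms may draw uniform elements of $\{0,\dots,N-1\}$, $N$ given in binary. *Parameters.* A security parameter $k$, users $\mathcal U$ with $|\mathcal U|=n$, a prime $p$ and a threshold $t$ with $1<t<n<p$, distinct points $X_i\in\mathbb Z_p\setminus\{0\}$ $(i\in\mathcal U)$, a vector length $m$, $r\in\mathbb Z_p$, $E(s)=rs$, and a group $\mathbb G$ of the family, of finite order $q$ with generator $g$. User $i$ has an input $\mathbf x_i\in\mathbb Z_p^m$. A set $C\subseteq\mathcal U$ of $n_C<t$ users is malicious; the server $S$ and the other users are honest. *Adversary.* The malicious users are controlled by a PPT algorithm $M_C$. In the registration and at the beginning of each of the five rounds, it gets the joint view so far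 and outputs what it wants to remember (e.g. its coin tosses), which honest users drop out in this phase, and an arbitrary message (or none) for every malicious user. The *view* consists of the public parameters, $C$, an arbitrary auxiliary input $z$ (e.g. the malicious users' private inputs), the registered keys of the honest parties, all outputs of $M_C$, and everything that $S$ sends to malicious users. Messages to $S$ travel over secure channels. In each round below, $S$ considers only users in the set of the previous round, aborts if it gets a malformed message or fewer than $t$ messages (the execution then ends), and sends its answer to the users of the new set. *Registration.* Honest users and $S$ publish keys $sig^{pk}_i$, $sig^{pk}_S$ from $DS.\mathrm{gen}(1^k)$; then the malicious users register keys of their choice. *Round 0.* User $i$ draws $a_i\in\{0,\dots,q-1\}$ and sends $com_i=g^{a_i}$ and its signature $\sigma_i^1$ on it. $S$ sends $\{(i,com_i,\sigma^1_i)\}_{i\in\mathcal U_1}$, where $\mathcal U_1$ is the set of senders. *Round 1.* User $i\in\mathcal U_1$ aborts unless all $\sigma_j^1$ are valid, $|\mathcal U_1|>t$, all $com_j$ are distinct and those of the other users lie in $\mathbb G$. It draws $s_i\in\mathbb Z_p$, forms Shamir shares $s_i^j$ with threshold $t$ (values at $X_j$ of a random polynomial of degree less than $t$ with constant term $s_i$),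 and sends $i\|j\|c_i^j\|\sigma_{i,j}^2$ for $j\in\mathcal U_1\setminus\{i\}$, where $c_i^j\leftarrow AE.\mathrm{enc}(com_j^{a_i},s_i^j)$ and $\sigma^2_{i,j}$ is a signature on $i\|j\|c_i^j$. $S$ sends all messages of the senders $\mathcal U_2\subseteq\mathcal U_1$. *Round 2.* User $i\in\mathcal U_2$ aborts unless, for all $j\in\mathcal U_2\setminus\{i\}$, $\sigma^2_{j,i}$ is valid and $c^i_j$ decrypts to an element $s_j^i$ of $\mathbb Z_p$. It sends $\mathbf y_i=(x_i^{(1)}+E(s_i),\,x_i^{(2)}+E(E(s_i)),\dots)$ with a signature $\sigma_i^3$ on it. $S$ lets $\mathcal U_3\subseteq\mathcal U_2$ be the senders with valid $\sigma_i^3$ and sends $\mathcal U_3$ and its signature $\sigma_S^4$ on it. *Round 3.* User $i\in\mathcal U_3$ aborts if $\sigma_S^4$ is invalid, and sends a signature $\sigma_i^5$ on $\mathcal U_3$. $S$ sends $\{(i,\sigma_i^5)\}_{i\in\mathcal U_4}$ for the senders $\mathcal U_4\subseteq\mathcal U_3$. *Round 4.* User $i\in\mathcal U_4$ aborts unless $|\mathcal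 U_4|\ge t$ and all $\sigma^5_j$ $(j\in\mathcal U_4)$ are valid for $\mathcal U_3$; it sends $s^i_{sum}=\sum_{j\in\mathcal U_3}s_j^i$ and a signature $\sigma_i^6$ on it. $S$ lets $\mathcal U_5\subseteq\mathcal U_4$ be the senders with valid $\sigma_i^6$, aborts if $|\mathcal U_5|<t$, and otherwise reconstructs $s=\sum_{j\in\mathcal U_3}s_j$ by interpolation at $0$ from the $s^i_{sum}$, $i\in\mathcal U_5$, and outputs $\sum_{j\in\mathcal U_3}\mathbf y_j-(E(s),E(E(s)),\dots)$. Here an honest user that has aborted sends nothing more. Let $REAL_C^{\mathcal U,t,k}(\mathbf x_{\mathcal U\setminus C},M_C)$ be the random variable given by the view at the end of such an execution. **Theorem (security against active malicious users with an honest server).** For every PPT algorithm $M_C$ there is a PPT simulator $SIM$ such that for all parameters as above, all $C\subseteq\mathcal U$ with $n_C<t$, all auxiliary inputs $z$ and all inputs $\mathbf x_{\mathcal U\setminus C}$ of the honest users, the output of $SIM$ on the public parameters (with $k$, $m$ in unary), $C$ and $z$, which does not get $\mathbf x_{\mathcal U\setminus C}$, is distributed identically to the real joint view of the malicious users: $$SIM_C^{\mathcal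 U,t,k}(M_C)\equiv REAL_C^{\mathcal U,t,k}(\mathbf x_{\mathcal U\setminus C},M_C).$$ -/

import Mathlib

namespace AHSecAgg

/-! ### Data, programs and running time -/

/-- Data handled by algorithms: binary trees whose leaves are natural numbers
(numbers are stored in binary, see `Value.size`). -/
inductive Value where
  | atom (a : ℕ)
  | pair (a b : Value)
  deriving DecidableEq

namespace Value

/-- Bit size. -/
def size : Value → ℕ
  | atom a => Nat.size a + 1
  | pair a b => a.size + b.size + 1

def fst : Value → Value
  | atom _ => atom 0
  | pair a _ => a

def snd : Value → Value
  | atom _ => atom 0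
  | pair _ b => b

/-- The number stored in a leaf. -/
def num : Value → ℕ
  | atom a => a
  | pair _ _ => 0

def ofBool (b : Bool) : Value := if b then atom 1 else atom 0

def ofList : List Value → Value
  | [] => atom 0
  | a :: l => pair a (ofList l)

def toList : Value → List Value
  | atom _ => []
  | pair a l => a :: l.toList

/-- The entry number `i` of a list. -/
def nth (v : Value) (i : ℕ) : Value := v.toList.getD i (atom 0)

def ofOption : Option Value → Value
  | none => atom 0
  | some v => pair (atom 1) v

def toOption : Value → Option Value
  | atom _ => none
  | pair _ v => some v

/-- The unary encoding `1^k`. -/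
def unary (k : ℕ) : Value := ofList (List.replicate k (atom 1))

/-- Arithmetic on a pair of numbers. -/
def arith (f : ℕ → ℕ → ℕ) (v : Value) : Value := atom (f v.fst.num v.snd.num)

end Value

open Value

/-- The uniform distribution on `{0, …, N - 1}` (and the constant `0` for `N = 0`). -/
noncomputable def uniformBelow (N : ℕ) : PMF ℕ :=
  if h : 0 < N then PMF.uniformOfFinset (Finset.range N) ⟨0, Finset.mem_range.2 h⟩
  else PMF.pure 0

/-- Probabilistic programs: a finite program text over trees and binary numbers, with
sequencing, branching, loops whose number of rounds is computed before they start,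
and uniform sampling below a given number. Since step counts are charged (see `Prog.run`)
and a polynomial clock can be computed, programs with polynomial step count compute exactly
what probabilistic polynomial-time machines (with uniform sampling) compute. -/
inductive Prog where
  | id
  | const (v : Value)
  | fst
  | snd
  | isAtom
  | eq
  | size
  | add
  | sub
  | mul
  | div
  | mod
  | rand
  | seq (P Q : Prog)
  | fork (P Q : Prog)
  | ite (B P Q : Prog)
  | loop (P : Prog)

namespace Prog

/-- One elementary operation: reading the input and writing the output is charged. -/
def step (v w : Value) : Value × ℕ := (w, v.size + w.size + 1)

/-- `j`-fold iteration of a charged computation; one extra step per round. -/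
noncomputable def iterate (f : Value → PMF (Value × ℕ)) : ℕ → Value → PMF (Value × ℕ)
  | 0, v => PMF.pure (v, 0)
  | j + 1, v => (f v).bind fun a => (iterate f j a.1).map fun b => (b.1, a.2 + b.2 + 1)

/-- The joint distribution of the output and of the number of bit operations charged. -/
noncomputable def run : Prog → Value → PMF (Value × ℕ)
  | id, v => PMF.pure (step v v)
  | const w, v => PMF.pure (step v w)
  | fst, v => PMF.pure (step v v.fst)
  | snd, v => PMF.pure (step v v.snd)
  | isAtom, v => PMF.pure (step v (match v with | .atom _ => .atom 1 | .pair _ _ => .atom 0))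
  | eq, v => PMF.pure (step v (ofBool (decide (v.fst = v.snd))))
  | size, v => PMF.pure (step v (.atom v.size))
  | add, v => PMF.pure (step v (arith (· + ·) v))
  | sub, v => PMF.pure (step v (arith (· - ·) v))
  | mul, v => PMF.pure (step v (arith (· * ·) v))
  | div, v => PMF.pure (step v (arith (· / ·) v))
  | mod, v => PMF.pure (step v (arith (· % ·) v))
  | rand, v => (uniformBelow v.num).map fun a => step v (.atom a)
  | seq P Q, v => (run P v).bind fun a => (run Q a.1).map fun b => (b.1, a.2 + b.2 + 1)
  | fork P Q, v =>
      (run P v).bind fun a => (run Q v).map fun b => (.pair a.1 b.1, a.2 + b.2 + 1)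
  | ite B P Q, v =>
      (run B v).bind fun a =>
        (if a.1 = .atom 0 then run Q v else run P v).map fun b => (b.1, a.2 + b.2 + 1)
  | loop P, v =>
      (iterate (run P) v.fst.num v.snd).map fun a => (a.1, v.size + a.2 + 1)

/-- The output distribution. -/
noncomputable def out (P : Prog) (v : Value) : PMF Value := (P.run v).map Prod.fst

/-- Probabilistic polynomial time: on every input and for all random choices, the number of
steps is at most a fixed polynomial in the size of the input. -/
def PPT (P : Prog) : Prop :=
  ∃ b : Polynomial ℕ, ∀ v, ∀ a ∈ (P.run v).support, a.2 ≤ b.eval v.size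

/-- The program computes the function `f` with certainty. -/
def Computes (P : Prog) (f : Value → Value) : Prop := ∀ v, P.out v = PMF.pure (f v)

end Prog

/-! ### Cryptographic primitives -/

/-- Digital signature schemes with (deterministic) verification and perfect correctness. -/
structure SignatureScheme where
  /-- on input `1^k`, outputs `(sk, pk)` -/
  gen : Prog
  /-- on input `(sk, m)`, outputs a signature -/
  sign : Prog
  /-- on input `(σ, pk, m)`, outputs a bit -/
  verifyProg : Prog
  verify : Value → Value → Value → Bool
  gen_ppt : gen.PPT
  sign_ppt : sign.PPT
  verify_ppt : verifyProg.PPT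
  verify_computes :
    verifyProg.Computes fun v => ofBool (verify v.fst v.snd.fst v.snd.snd)
  correct : ∀ (k : ℕ), ∀ key ∈ (gen.out (unary k)).support, ∀ m : Value,
    ∀ σ ∈ (sign.out (pair key.fst m)).support, verify σ key.snd m = true

/-- Symmetric authenticated encryption schemes with perfect correctness. -/
structure AEScheme where
  /-- on input `1^k`, outputs a key -/
  gen : Prog
  /-- on input `(key, m)`, outputs a ciphertext -/
  enc : Prog
  /-- on input `(key, c)`, outputs a message or the error symbol -/
  decProg : Prog
  dec : Value → Value → Option Value
  gen_ppt : gen.PPT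
  enc_ppt : enc.PPT
  dec_ppt : decProg.PPT
  dec_computes : decProg.Computes fun v => ofOption (dec v.fst v.snd)
  correct : ∀ (k : ℕ), ∀ key ∈ (gen.out (unary k)).support, ∀ m : Value,
    ∀ c ∈ (enc.out (pair key m)).support, dec key c = some m

/-- A family of groups for the Diffie-Hellman key agreement, with an encoding of the
elements for which membership and powers are computable in polynomial time. -/
structure GroupFamily where
  Idx : Type
  G : Idx → Type
  grp : ∀ d, Group (G d)
  /-- description of the group -/
  code : Idx → Value
  enc : ∀ d, G d → Value
  enc_injective : ∀ d, Function.Injective (enc d)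
  /-- on input (description, encoding of `h`, `e`), outputs the encoding of `h ^ e`,
  or an error symbol if there is no such `h` -/
  pow : Prog
  pow_ppt : pow.PPT
  pow_enc : ∀ (d : Idx) (h : G d) (e : ℕ),
    pow.out (pair (code d) (pair (enc d h) (atom e))) =
      PMF.pure (ofOption (some (enc d (h ^ e))))
  pow_error : ∀ (d : Idx) (v : Value) (e : ℕ), v ∉ Set.range (enc d) →
    pow.out (pair (code d) (pair v (atom e))) = PMF.pure (ofOption none)

attribute [instance] GroupFamily.grp

/-- The public inputs of one execution. The set of users is `Fin n`. -/
structure Params (DH : GroupFamily) where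
  /-- security parameter -/
  k : ℕ
  /-- number of users -/
  n : ℕ
  /-- threshold -/
  t : ℕ
  /-- length of the input vectors -/
  m : ℕ
  /-- size of the field -/
  p : ℕ
  p_prime : p.Prime
  one_lt_t : 1 < t
  t_lt_n : t < n
  n_lt_p : n < p
  /-- the points that identify the users in the secret sharing -/
  X : Fin n → ZMod p
  X_injective : Function.Injective X
  X_ne_zero : ∀ i, X i ≠ 0
  /-- masking parameter -/
  r : ZMod p
  /-- the group, its generator and its order -/
  d : DH.Idx
  g : DH.G d
  q : ℕ
  q_pos : 0 < q
  card_eq : Nat.card (DH.G d) = q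
  generates : ∀ h : DH.G d, h ∈ Subgroup.zpowers g

instance {DH : GroupFamily} (P : Params DH) : Fact P.p.Prime := ⟨P.p_prime⟩

/-! ### The protocol -/

/-- Independent sampling of a family indexed by `Fin n`. -/
noncomputable def sampleAll {α : Type} : (n : ℕ) → (Fin n → PMF α) → PMF (Fin n → α)
  | 0, _ => PMF.pure Fin.elim0
  | n + 1, f => (f 0).bind fun a =>
      (sampleAll n fun i => f i.succ).map fun b => Fin.cons a b

/-- The elements of a set of users in increasing order. -/
def members {n : ℕ} (U : Finset (Fin n)) : List (Fin n) :=
  (List.finRange n).filter fun i => decide (i ∈ U)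

def idVal {n : ℕ} (i : Fin n) : Value := atom i

/-- A set of users as a message. -/
def setVal {n : ℕ} (U : Finset (Fin n)) : Value := ofList ((members U).map idVal)

def fieldVal {p : ℕ} (a : ZMod p) : Value := atom a.val

/-- A number below `p` is read as an element of `ZMod p`; all else is malformed. -/
def readField (p : ℕ) : Value → Option (ZMod p)
  | atom a => if a < p then some (a : ZMod p) else none
  | pair _ _ => none

def vecVal {p m : ℕ} (y : Fin m → ZMod p) : Value := ofList (List.ofFn fun l => fieldVal (y l))

/-- The message `i ‖ j ‖ c`. -/
def header {n : ℕ} (i j : Fin n) (c : Value) : Value := pair (idVal i) (pair (idVal j) c)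

/-- The Shamir share at the point `z` of the secret `s`, for the polynomial with constant term
`s` and further coefficients `a`. -/
def share {p l : ℕ} (s : ZMod p) (a : Fin l → ZMod p) (z : ZMod p) : ZMod p :=
  s + ∑ j : Fin l, a j * z ^ ((j : ℕ) + 1)

/-- The masking function `E(s) = r s`. -/
def E {p : ℕ} (r s : ZMod p) : ZMod p := r * s

/-- The mask `(E(s), E(E(s)), …)`. -/
def mask {p m : ℕ} (r s : ZMod p) : Fin m → ZMod p := fun l => (E r)^[(l : ℕ) + 1] s

section Protocol

open scoped Classical

variable (DS : SignatureScheme) (AE : AEScheme) (DH : GroupFamily) (P : Params DH)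

/-- `DH.agree`: the error case is that `v` is not a group element. -/
noncomputable def agree (a : ℕ) (v : Value) : Option Value :=
  if h : ∃ y : DH.G P.d, DH.enc P.d y = v then some (DH.enc P.d (h.choose ^ a)) else none

/-- The public inputs together with the set `C` of malicious users and an auxiliary input `aux`
(the private data of the malicious users, for instance) as one value. Lengths and the security
parameter are in unary, field elements and `t`, `p`, `q` in binary. -/
noncomputable def publicVal (C : Finset (Fin P.n)) (aux : Value) : Value :=
  ofList [unary P.k, ofList (List.ofFn fun i => ofBool (decide (i ∈ C))), atom P.t, unary P.m,
    atom P.p, ofList (List.ofFn fun i => fieldVal (P.X i)), fieldVal P.r,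
    DH.code P.d, DH.enc P.d P.g, atom P.q, aux]

/-- In every phase the adversary outputs `(memory, drops, messages)`: what it remembers (its coin
tosses, for instance), which honest users drop out, and what the malicious users send. -/
def dropped {n : ℕ} (w : Value) (i : Fin n) : Prop := nth w.snd.fst i ≠ atom 0

/-- What reaches the server in a round (`none`: nothing arrives from this user). -/
noncomputable def sent {n : ℕ} (C : Finset (Fin n)) (w : Value) (honest : Fin n → Option Value)
    (i : Fin n) : Option Value :=
  if i ∈ C then toOption (nth w.snd.snd i) else if dropped w i then none else honest i

/-- The server collects the messages of users in `U`. It aborts on a malformed message or if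
there are fewer than `t` messages. -/
noncomputable def collect {n : ℕ} (t : ℕ) (U : Finset (Fin n)) (msg : Fin n → Option Value)
    (WellFormed : Fin n → Value → Prop) : Option (Finset (Fin n)) :=
  let V := U.filter fun i => (msg i).isSome
  if t ≤ V.card ∧ ∀ i ∈ V, ∀ v, msg i = some v → WellFormed i v then some V else none

/-- The malicious users receive what the server sends to all users in `U`, if one of them
is in `U`. -/
noncomputable def deliver {n : ℕ} (C U : Finset (Fin n)) (v : Value) : Value :=
  if (C ∩ U).Nonempty then pair (atom 1) v else atom 0

/-- Continue an execution unless the server has aborted; the first component is the joint view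
of the malicious users so far. -/
noncomputable def thenRound {α β : Type} (a : PMF (Value × Option α))
    (f : Value → α → PMF (Value × Option β)) : PMF (Value × Option β) :=
  a.bind fun b => match b.2 with
    | none => PMF.pure (b.1, none)
    | some s => f b.1 s

/-- Signature keys. -/
structure Keys (n : ℕ) where
  sk : Fin n → Value
  pk : Fin n → Value
  skS : Value
  pkS : Value

/-- Key registration: the honest parties generate and publish their signature keys, then the
malicious users register public keys of their choice. -/
noncomputable def registration (M : Prog) (C : Finset (Fin P.n)) (aux : Value) :
    PMF (Value × Option (Keys P.n)) := do
  let key ← sampleAll P.n fun i =>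
    if i ∈ C then PMF.pure (atom 0) else DS.gen.out (unary P.k)
  let keyS ← DS.gen.out (unary P.k)
  let view := pair (publicVal DH P C aux)
    (pair (ofList (List.ofFn fun i => (key i).snd)) keyS.snd)
  let w ← M.out view
  PMF.pure (pair view w, some
    { sk := fun i => (key i).fst
      pk := fun i => if i ∈ C then nth w.snd.snd i else (key i).snd
      skS := keyS.fst
      pkS := keyS.snd })

/-- State after the round of key agreements. -/
structure State0 (n : ℕ) where
  U1 : Finset (Fin n)
  /-- secret exponents of the honest users -/
  comSk : Fin n → ℕ
  /-- public keys and their signatures, as received by the server -/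
  comPk : Fin n → Value
  σ1 : Fin n → Value

/-- Round 0, key agreements. -/
noncomputable def round0 (M : Prog) (C : Finset (Fin P.n)) (K : Keys P.n) (view : Value) :
    PMF (Value × Option (State0 P.n)) := do
  let w ← M.out view
  let a ← sampleAll P.n fun i =>
    if i ∈ C then PMF.pure 0 else uniformBelow P.q
  let σ ← sampleAll P.n fun i =>
    if i ∈ C then PMF.pure (atom 0)
    else DS.sign.out (pair (K.sk i) (DH.enc P.d (P.g ^ a i)))
  let msg := sent C w fun i => some (pair (DH.enc P.d (P.g ^ a i)) (σ i))
  match collect P.t Finset.univ msg (fun _ v => ∃ b c, v = pair b c) with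
  | none => PMF.pure (pair view w, none)
  | some U1 =>
    let content := fun i => (msg i).getD (atom 0)
    let broadcast := ofList ((members U1).map fun i => pair (idVal i) (content i))
    PMF.pure (pair (pair view w) (deliver C U1 broadcast), some
      { U1 := U1
        comSk := a
        comPk := fun i => (content i).fst
        σ1 := fun i => (content i).snd })

/-- State after the round of key sharing. -/
structure State1 (n p : ℕ) where
  U2 : Finset (Fin n)
  /-- `none` for users that have aborted, otherwise the secret key and all its shares -/
  secret : Fin n → Option (ZMod p × (Fin n → ZMod p))
  /-- the message of each user as received by the server -/
  content : Fin n → Value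

/-- The entry `i ‖ j ‖ c ‖ σ` of a list, as the pair `(c, σ)`. -/
def entry {n : ℕ} (i j : Fin n) (v : Value) : Value :=
  (((v.toList).find? fun e =>
    decide (e.fst = idVal i ∧ e.snd.fst = idVal j)).getD (atom 0)).snd.snd

/-- The check of an honest user at the beginning of round 1. -/
def Check1 (K : Keys P.n) (S : State0 P.n) (i : Fin P.n) : Prop :=
  (∀ j ∈ S.U1, DS.verify (S.σ1 j) (K.pk j) (S.comPk j) = true) ∧
  P.t < S.U1.card ∧
  (∀ j ∈ S.U1, ∀ l ∈ S.U1, S.comPk j = S.comPk l → j = l) ∧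
  ∀ j ∈ S.U1.erase i, (agree DH P (S.comSk i) (S.comPk j)).isSome

/-- Round 1, key sharing. -/
noncomputable def round1 (M : Prog) (C : Finset (Fin P.n)) (K : Keys P.n) (S0 : State0 P.n)
    (view : Value) : PMF (Value × Option (State1 P.n P.p)) := do
  let w ← M.out view
  let h ← sampleAll P.n fun i =>
    if i ∉ C ∧ i ∈ S0.U1 ∧ Check1 DS DH P K S0 i then do
      let s ← PMF.uniformOfFintype (ZMod P.p)
      let a ← sampleAll (P.t - 1) fun _ => PMF.uniformOfFintype (ZMod P.p)
      let sh : Fin P.n → ZMod P.p := fun j => share s a (P.X j)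
      let cσ ← sampleAll P.n fun j =>
        if j ∈ S0.U1.erase i then do
          let key := (agree DH P (S0.comSk i) (S0.comPk j)).getD (atom 0)
          let c ← AE.enc.out (pair key (fieldVal (sh j)))
          let σ ← DS.sign.out (pair (K.sk i) (header i j c))
          PMF.pure (pair c σ)
        else PMF.pure (atom 0)
      PMF.pure (some ((s, sh),
        ofList ((members (S0.U1.erase i)).map fun j => header i j (cσ j))))
    else PMF.pure none
  let msg := sent C w fun i => (h i).map Prod.snd
  match collect P.t S0.U1 msg (fun i v => ∃ c σ : Fin P.n → Value,
      v = ofList ((members (S0.U1.erase i)).map fun j => header i j (pair (c j) (σ j)))) with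
  | none => PMF.pure (pair view w, none)
  | some U2 =>
    let content := fun i => (msg i).getD (atom 0)
    let broadcast := ofList ((members U2).flatMap fun j => (content j).toList)
    PMF.pure (pair (pair view w) (deliver C U2 broadcast), some
      { U2 := U2
        secret := fun i => (h i).map Prod.fst
        content := content })

/-- State after the round of masking. -/
structure State2 (n m p : ℕ) where
  U3 : Finset (Fin n)
  /-- `none` for users that have aborted, otherwise the shares `s_j^i` held by the user `i` -/
  held : Fin n → Option (Fin n → ZMod p)
  /-- masked vectors as received by the server -/
  y : Fin n → Fin m → ZMod p
  /-- the server's signature on the list of users -/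
  σ4 : Value

/-- The share of the secret of `j` that user `i` decrypts. -/
noncomputable def openShare (S0 : State0 P.n) (S1 : State1 P.n P.p) (i j : Fin P.n) :
    Option (ZMod P.p) := do
  let key ← agree DH P (S0.comSk i) (S0.comPk j)
  let v ← AE.dec key (entry j i (S1.content j)).fst
  readField P.p v

/-- The check of an honest user at the beginning of round 2. -/
def Check2 (K : Keys P.n) (S0 : State0 P.n) (S1 : State1 P.n P.p) (i : Fin P.n) : Prop :=
  ∀ j ∈ S1.U2.erase i,
    DS.verify (entry j i (S1.content j)).snd (K.pk j)
      (header j i (entry j i (S1.content j)).fst) = true ∧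
    (openShare AE DH P S0 S1 i j).isSome

/-- Round 2, masking. The private inputs `x` of the honest users are used here only. -/
noncomputable def round2 (M : Prog) (C : Finset (Fin P.n))
    (x : {i : Fin P.n // i ∉ C} → Fin P.m → ZMod P.p) (K : Keys P.n) (S0 : State0 P.n)
    (S1 : State1 P.n P.p) (view : Value) :
    PMF (Value × Option (State2 P.n P.m P.p)) := do
  let w ← M.out view
  let h ← sampleAll P.n fun i =>
    if hi : i ∉ C ∧ i ∈ S1.U2 ∧ Check2 DS AE DH P K S0 S1 i then
      match S1.secret i with
      | none => PMF.pure none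
      | some (s, sh) => do
        let y : Fin P.m → ZMod P.p := x ⟨i, hi.1⟩ + mask P.r s
        let σ ← DS.sign.out (pair (K.sk i) (vecVal y))
        let held : Fin P.n → ZMod P.p := fun j =>
          if j = i then sh i else (openShare AE DH P S0 S1 i j).getD 0
        PMF.pure (some (held, pair (vecVal y) σ))
    else PMF.pure none
  let msg := sent C w fun i => (h i).map Prod.snd
  match collect P.t S1.U2 msg
      (fun _ v => ∃ (y : Fin P.m → ZMod P.p) (σ : Value), v = pair (vecVal y) σ) with
  | none => PMF.pure (pair view w, none)
  | some V =>
    let content := fun i => (msg i).getD (atom 0)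
    let U3 := V.filter fun j => DS.verify (content j).snd (K.pk j) (content j).fst = true
    let σ4 ← DS.sign.out (pair K.skS (setVal U3))
    PMF.pure (pair (pair view w) (deliver C U3 (pair (setVal U3) σ4)), some
      { U3 := U3
        held := fun i => (h i).map Prod.fst
        y := fun i l => (readField P.p (nth (content i).fst l)).getD 0
        σ4 := σ4 })

/-- State after the consistency check. -/
structure State3 (n : ℕ) where
  U4 : Finset (Fin n)
  σ5 : Fin n → Value
  /-- the honest users that have not aborted -/
  active : Fin n → Bool

/-- Round 3, consistency check. -/
noncomputable def round3 (M : Prog) (C : Finset (Fin P.n)) (K : Keys P.n)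
    (S2 : State2 P.n P.m P.p) (view : Value) : PMF (Value × Option (State3 P.n)) := do
  let w ← M.out view
  let h ← sampleAll P.n fun i =>
    if i ∉ C ∧ i ∈ S2.U3 ∧ (S2.held i).isSome ∧
        DS.verify S2.σ4 K.pkS (setVal S2.U3) = true then
      (DS.sign.out (pair (K.sk i) (setVal S2.U3))).map some
    else PMF.pure none
  let msg := sent C w h
  match collect P.t S2.U3 msg (fun _ _ => True) with
  | none => PMF.pure (pair view w, none)
  | some U4 =>
    let σ5 := fun i => (msg i).getD (atom 0)
    let broadcast := ofList ((members U4).map fun i => pair (idVal i) (σ5 i))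
    PMF.pure (pair (pair view w) (deliver C U4 broadcast), some
      { U4 := U4, σ5 := σ5, active := fun i => (h i).isSome })

/-- Round 4, unmasking, with the output of the server. -/
noncomputable def round4 (M : Prog) (C : Finset (Fin P.n)) (K : Keys P.n)
    (S2 : State2 P.n P.m P.p) (S3 : State3 P.n) (view : Value) :
    PMF (Value × Option (Fin P.m → ZMod P.p)) := do
  let w ← M.out view
  let h ← sampleAll P.n fun i =>
    if i ∉ C ∧ i ∈ S3.U4 ∧ S3.active i = true ∧ P.t ≤ S3.U4.card ∧
        ∀ j ∈ S3.U4, DS.verify (S3.σ5 j) (K.pk j) (setVal S2.U3) = true then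
      match S2.held i with
      | none => PMF.pure none
      | some sh => do
        let sSum : Value := fieldVal (∑ j ∈ S2.U3, sh j)
        let σ ← DS.sign.out (pair (K.sk i) sSum)
        PMF.pure (some (pair sSum σ))
    else PMF.pure none
  let msg := sent C w h
  match collect P.t S3.U4 msg (fun _ v => ∃ (a : ZMod P.p) (σ : Value), v = pair (fieldVal a) σ) with
  | none => PMF.pure (pair view w, none)
  | some V =>
    let content := fun i => (msg i).getD (atom 0)
    let U5 := V.filter fun j => DS.verify (content j).snd (K.pk j) (content j).fst = true
    if P.t ≤ U5.card then
      let sTotal : ZMod P.p := (Lagrange.interpolate U5 P.X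
        fun i => (readField P.p (content i).fst).getD 0).eval 0
      PMF.pure (pair view w, some ((∑ j ∈ S2.U3, S2.y j) - mask P.r sTotal))
    else PMF.pure (pair view w, none)

/-- An execution of the protocol with an honest server and malicious users `C` controlled by `M`:
the joint view of the malicious users, and the output of the server (`none` if it aborts).
The view consists of the public inputs, the registered keys, everything the adversary has
output (hence remembered) and everything the malicious users have received from the server. -/
noncomputable def execution (M : Prog) (C : Finset (Fin P.n)) (aux : Value)
    (x : {i : Fin P.n // i ∉ C} → Fin P.m → ZMod P.p) :
    PMF (Value × Option (Fin P.m → ZMod P.p)) :=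
  thenRound (registration DS DH P M C aux) fun v K =>
  thenRound (round0 DS DH P M C K v) fun v S0 =>
  thenRound (round1 DS AE DH P M C K S0 v) fun v S1 =>
  thenRound (round2 DS AE DH P M C x K S0 S1 v) fun v S2 =>
  thenRound (round3 DS DH P M C K S2 v) fun v S3 =>
  round4 DS DH P M C K S2 S3 v

/-- The joint view of the malicious users in a real execution. -/
noncomputable def REAL (M : Prog) (C : Finset (Fin P.n)) (aux : Value)
    (x : {i : Fin P.n // i ∉ C} → Fin P.m → ZMod P.p) : PMF Value :=
  (execution DS AE DH P M C aux x).map Prod.fst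

end Protocol

end AHSecAgg

/-! ### Running times of programs -/

/-! The honest server shields the inputs. The masked vectors of round 2 and the sums of shares of
round 4 go to the server alone. From round 2 the malicious users get back only the set `U3` with the
server's signature on it, and from round 4 nothing. An honest message influences `U3` only by its
presence, since it is well formed and, by perfect correctness, validly signed. Its presence is
determined by the state before the round and by the drop-outs that the adversary chooses. So the
simulator plays the server and the honest users itself, with keys, exponents, secrets and shares
drawn as in the protocol, and in round 2 merely records who sends. The two views then agree exactly,
and neither hiding nor unforgeability enters.

`Sim.round2_eq` is this argument. The other lemmas `Sim.registration_eq`, `Sim.round0_eq`,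
`Sim.round1_eq` and `Sim.round3_eq` say that a simulated step is the image of the real one under a
map of states that forgets what the simulator does not keep; `Sim.round4_eq` compares the views
only. `thenRound_map_fst` chains the rounds, with `Sim.simulate_eq` as the result.

The rest of the work is to exhibit the simulator as a program with polynomial step count. `PT`
(random) and `PD` (deterministic) describe functions on coded data that are computable in polynomial
time. They are closed under composition, case distinction, sampling and list operations, so the
bound for the simulator follows from the shape of its definition. List operations rest on
`Prog.fold_ppt`: a loop over a list is polynomial if each round lengthens the accumulator by a
bounded amount. Calls of the adversary and of the primitives enter through `PT.out`. -/

theorem Polynomial.eval_mono_nat (b : Polynomial ℕ) {x y : ℕ} (h : x ≤ y) :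
    b.eval x ≤ b.eval y := by
  rw [Polynomial.eval_eq_sum, Polynomial.eval_eq_sum]
  exact Finset.sum_le_sum fun i _ => Nat.mul_le_mul_left _ (Nat.pow_le_pow_left h i)

namespace Nat

theorem size_le_self (n : ℕ) : n.size ≤ n := Nat.size_le.2 n.lt_two_pow_self

theorem size_add_le (a b : ℕ) : (a + b).size ≤ a.size + b.size + 1 := by
  rw [Nat.size_le]
  have ha := Nat.lt_size_self a
  have hb := Nat.lt_size_self b
  have h1 : 2 ^ a.size ≤ 2 ^ (a.size + b.size) := Nat.pow_le_pow_right (by norm_num) (by omega)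
  have h2 : 2 ^ b.size ≤ 2 ^ (a.size + b.size) := Nat.pow_le_pow_right (by norm_num) (by omega)
  rw [pow_succ]
  omega

theorem size_mul_le (a b : ℕ) : (a * b).size ≤ a.size + b.size := by
  rw [Nat.size_le, pow_add]
  exact Nat.mul_lt_mul'' (Nat.lt_size_self a) (Nat.lt_size_self b)

end Nat

namespace AHSecAgg

open Value

theorem Value.size_fst_le (v : Value) : v.fst.size ≤ v.size := by
  cases v
  · simp [Value.size, Value.fst]
  · simp [Value.size, Value.fst]; omega

theorem Value.size_snd_le (v : Value) : v.snd.size ≤ v.size := by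
  cases v
  · simp [Value.size, Value.snd]
  · simp [Value.size, Value.snd]; omega

theorem Value.size_num_lt (v : Value) : v.num.size < v.size := by
  cases v <;> simp [Value.size, Value.num]

/-- The inequality is not strict because `N = 0` yields the constant `0`. -/
theorem uniformBelow_support_le (N : ℕ) {a : ℕ} (h : a ∈ (uniformBelow N).support) : a ≤ N := by
  unfold uniformBelow at h
  split_ifs at h with hN
  · exact (Finset.mem_range.1 ((PMF.mem_support_uniformOfFinset_iff _ _).1 h)).le
  · simp at h; omega

namespace Prog

/-- `j`-fold iteration of a random function. -/
noncomputable def iterP {α : Type} (f : α → PMF α) : ℕ → α → PMF α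
  | 0, v => PMF.pure v
  | j + 1, v => (f v).bind (iterP f j)

/-- Splits off the last round, where the definition splits off the first; invariants of loops are
proved in this form. -/
theorem iterP_succ' {α : Type} (f : α → PMF α) (j : ℕ) (v : α) :
    iterP f (j + 1) v = (iterP f j v).bind f := by
  induction j generalizing v with
  | zero => simp [iterP]
  | succ j ih =>
    calc iterP f (j + 1 + 1) v = (f v).bind fun a => (iterP f j a).bind f :=
          congrArg _ (funext ih)
      _ = (iterP f (j + 1) v).bind f := by rw [← PMF.bind_bind]; rfl

theorem iterP_pure {α : Type} (f : α → α) (j : ℕ) (v : α) :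
    iterP (fun x => PMF.pure (f x)) j v = PMF.pure (f^[j] v) := by
  induction j generalizing v with
  | zero => simp [iterP]
  | succ j ih => simp [iterP, ih]

theorem map_fst_iterate (f : Value → PMF (Value × ℕ)) (j : ℕ) (v : Value) :
    (iterate f j v).map Prod.fst = iterP (fun x => (f x).map Prod.fst) j v := by
  induction j generalizing v with
  | zero => simp [iterate, iterP, PMF.pure_map]
  | succ j ih =>
    simp only [iterate, iterP, PMF.map_bind, PMF.map_comp, PMF.bind_map]
    congr 1
    funext a
    rw [Function.comp_apply, ← ih]
    rfl

theorem mem_support_out {P : Prog} {v a : Value} :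
    a ∈ (P.out v).support ↔ ∃ c, (a, c) ∈ (P.run v).support := by
  simp [out]

theorem out_seq (P Q : Prog) (v : Value) : (seq P Q).out v = (P.out v).bind Q.out := by
  simp only [out, run, PMF.map_bind, PMF.map_comp, PMF.bind_map]
  rfl

theorem out_fork (P Q : Prog) (v : Value) :
    (fork P Q).out v = (P.out v).bind fun a => (Q.out v).map fun b => pair a b := by
  simp only [out, run, PMF.map_bind, PMF.map_comp, PMF.bind_map]
  rfl

theorem out_ite (B P Q : Prog) (v : Value) :
    (ite B P Q).out v = (B.out v).bind fun a => if a = atom 0 then Q.out v else P.out v := by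
  simp only [out, run, PMF.map_bind, PMF.map_comp, PMF.bind_map]
  congr 1
  funext a
  simp only [Function.comp_def]
  split_ifs <;> rfl

theorem out_loop (P : Prog) (v : Value) :
    (loop P).out v = iterP P.out v.fst.num v.snd := by
  simp only [out, run, PMF.map_comp]
  exact map_fst_iterate P.run _ _

theorem out_of_run_pure {P : Prog} {v w : Value} (h : P.run v = PMF.pure (step v w)) :
    P.out v = PMF.pure w := by
  rw [out, h, PMF.pure_map]; rfl

theorem size_le_cost_iterate {f : Value → PMF (Value × ℕ)}
    (hf : ∀ v, ∀ a ∈ (f v).support, a.1.size ≤ a.2) (j : ℕ) (v : Value) :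
    ∀ a ∈ (iterate f j v).support, a.1.size ≤ v.size + a.2 := by
  induction j generalizing v with
  | zero => intro a ha; simp [iterate] at ha; subst ha; simp
  | succ j ih =>
    intro a ha
    simp only [iterate, PMF.mem_support_bind_iff, PMF.mem_support_map_iff] at ha
    obtain ⟨b, hb, c, hc, rfl⟩ := ha
    have := hf _ _ hb
    have := ih _ _ hc
    dsimp only
    omega

/-- Every elementary operation pays for writing its output, so time bounds size. This is what makes
polynomial time closed under composition. -/
theorem size_le_cost (P : Prog) : ∀ v, ∀ a ∈ (P.run v).support, a.1.size ≤ a.2 := by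
  induction P with
  | seq P Q hP hQ =>
    intro v a ha
    simp only [run, PMF.mem_support_bind_iff, PMF.mem_support_map_iff] at ha
    obtain ⟨b, hb, c, hc, rfl⟩ := ha
    have := hQ _ _ hc
    dsimp only; omega
  | fork P Q hP hQ =>
    intro v a ha
    simp only [run, PMF.mem_support_bind_iff, PMF.mem_support_map_iff] at ha
    obtain ⟨b, hb, c, hc, rfl⟩ := ha
    have := hP _ _ hb
    have := hQ _ _ hc
    simp only [Value.size]; omega
  | ite B P Q hB hP hQ =>
    intro v a ha
    simp only [run, PMF.mem_support_bind_iff, PMF.mem_support_map_iff] at ha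
    obtain ⟨b, hb, c, hc, rfl⟩ := ha
    dsimp only
    split_ifs at hc
    · have := hQ _ _ hc; omega
    · have := hP _ _ hc; omega
  | loop P hP =>
    intro v a ha
    simp only [run, PMF.mem_support_map_iff] at ha
    obtain ⟨b, hb, rfl⟩ := ha
    -- A loop of zero rounds returns its input, so this bound contains the initial size; the charge
    -- `v.size` for entering the loop pays for it.
    have := size_le_cost_iterate hP _ _ _ hb
    have := v.size_snd_le
    dsimp only; omega
  | rand =>
    intro v a ha
    simp only [run, PMF.mem_support_map_iff] at ha
    obtain ⟨b, hb, rfl⟩ := ha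
    simp only [step]; omega
  | _ =>
    intro v a ha
    simp only [run, PMF.mem_support_pure_iff] at ha
    subst ha
    simp only [step]; omega

theorem PPT.exists_size_bound {P : Prog} (h : P.PPT) :
    ∃ b : Polynomial ℕ, ∀ v, ∀ a ∈ (P.out v).support, a.size ≤ b.eval v.size := by
  obtain ⟨b, hb⟩ := h
  refine ⟨b, fun v a ha => ?_⟩
  obtain ⟨c, hc⟩ := mem_support_out.1 ha
  exact (size_le_cost P v _ hc).trans (hb v _ hc)

theorem PPT.of_step {P : Prog} {f : Value → Value} (b : Polynomial ℕ)
    (h : ∀ v, P.run v = PMF.pure (step v (f v))) (hf : ∀ v, (f v).size ≤ b.eval v.size) :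
    P.PPT := by
  refine ⟨Polynomial.X + b + 1, fun v a ha => ?_⟩
  rw [h, PMF.mem_support_pure_iff] at ha
  subst ha
  have := hf v
  simp only [step, Polynomial.eval_add, Polynomial.eval_X, Polynomial.eval_one]
  omega

theorem ppt_id : id.PPT := .of_step .X (fun _ => rfl) (by simp)

theorem ppt_const (w : Value) : (const w).PPT :=
  .of_step (.C w.size) (fun _ => rfl) (by simp)

theorem ppt_fst : fst.PPT :=
  .of_step .X (fun _ => rfl) (by simpa using Value.size_fst_le)

theorem ppt_snd : snd.PPT :=
  .of_step .X (fun _ => rfl) (by simpa using Value.size_snd_le)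

theorem ppt_isAtom : isAtom.PPT :=
  .of_step (.C 2) (fun _ => rfl) (fun v => by cases v <;> simp [Value.size])

theorem ppt_eq : eq.PPT :=
  .of_step (.C 2) (fun _ => rfl) (fun v => by
    unfold ofBool; split_ifs <;> simp [Value.size])

theorem ppt_size : size.PPT :=
  .of_step (.X + 1) (fun _ => rfl) (fun v => by
    have := Nat.size_le_self v.size
    simp [Value.size]; omega)

theorem size_arith_operands (v : Value) : v.fst.num.size + v.snd.num.size ≤ 2 * v.size := by
  have := v.size_fst_le
  have := v.size_snd_le
  have := v.fst.size_num_lt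
  have := v.snd.size_num_lt
  omega

theorem ppt_add : add.PPT :=
  .of_step (2 * .X + 2) (fun _ => rfl) (fun v => by
    have := Nat.size_add_le v.fst.num v.snd.num
    have := size_arith_operands v
    simp [Value.size, arith]; omega)

theorem ppt_sub : sub.PPT :=
  .of_step (2 * .X + 2) (fun _ => rfl) (fun v => by
    have := Nat.size_le_size (Nat.sub_le v.fst.num v.snd.num)
    have := size_arith_operands v
    simp [Value.size, arith]; omega)

theorem ppt_mul : mul.PPT :=
  .of_step (2 * .X + 2) (fun _ => rfl) (fun v => by
    have := Nat.size_mul_le v.fst.num v.snd.num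
    have := size_arith_operands v
    simp [Value.size, arith]; omega)

theorem ppt_mod : mod.PPT :=
  .of_step (2 * .X + 2) (fun _ => rfl) (fun v => by
    have := Nat.size_le_size (Nat.mod_le v.fst.num v.snd.num)
    have := size_arith_operands v
    simp [Value.size, arith]; omega)

theorem ppt_rand : rand.PPT := by
  refine ⟨2 * .X + 2, fun v a ha => ?_⟩
  simp only [run, PMF.mem_support_map_iff] at ha
  obtain ⟨b, hb, rfl⟩ := ha
  have := Nat.size_le_size (uniformBelow_support_le _ hb)
  have := v.size_num_lt
  simp [step, Value.size]; omega

theorem PPT.seq {P Q : Prog} (hP : P.PPT) (hQ : Q.PPT) : (seq P Q).PPT := by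
  obtain ⟨b, hb⟩ := hP
  obtain ⟨c, hc⟩ := hQ
  -- The second program runs on a value of size at most `b.eval v.size`; natural coefficients make
  -- `c` monotone.
  refine ⟨b + c.comp b + 1, fun v a ha => ?_⟩
  simp only [run, PMF.mem_support_bind_iff, PMF.mem_support_map_iff] at ha
  obtain ⟨x, hx, y, hy, rfl⟩ := ha
  have h1 := hb _ _ hx
  have h2 := hc _ _ hy
  have h3 := c.eval_mono_nat ((size_le_cost P _ _ hx).trans h1)
  simp [Polynomial.eval_comp]; omega

theorem PPT.fork {P Q : Prog} (hP : P.PPT) (hQ : Q.PPT) : (fork P Q).PPT := by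
  obtain ⟨b, hb⟩ := hP
  obtain ⟨c, hc⟩ := hQ
  refine ⟨b + c + 1, fun v a ha => ?_⟩
  simp only [run, PMF.mem_support_bind_iff, PMF.mem_support_map_iff] at ha
  obtain ⟨x, hx, y, hy, rfl⟩ := ha
  have h1 := hb _ _ hx
  have h2 := hc _ _ hy
  simp; omega

theorem PPT.ite {B P Q : Prog} (hB : B.PPT) (hP : P.PPT) (hQ : Q.PPT) : (ite B P Q).PPT := by
  obtain ⟨b, hb⟩ := hP
  obtain ⟨c, hc⟩ := hQ
  obtain ⟨d, hd⟩ := hB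
  refine ⟨b + c + d + 1, fun v a ha => ?_⟩
  simp only [run, PMF.mem_support_bind_iff, PMF.mem_support_map_iff] at ha
  obtain ⟨x, hx, y, hy, rfl⟩ := ha
  have h1 := hd _ _ hx
  simp only [Polynomial.eval_add, Polynomial.eval_one]
  split_ifs at hy
  · have h2 := hc _ _ hy; omega
  · have h2 := hb _ _ hy; omega

/-- Cost of an iteration whose intermediate values are bounded. -/
theorem cost_iterate_le {P : Prog} {b : Polynomial ℕ}
    (hb : ∀ v, ∀ a ∈ (P.run v).support, a.2 ≤ b.eval v.size) (B j : ℕ) (v : Value)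
    (h : ∀ i ≤ j, ∀ a ∈ (iterP P.out i v).support, a.size ≤ B) :
    ∀ a ∈ (iterate P.run j v).support, a.2 ≤ j * (b.eval B + 1) := by
  induction j generalizing v with
  | zero => intro a ha; simp [iterate] at ha; subst ha; simp
  | succ j ih =>
    intro a ha
    simp only [iterate, PMF.mem_support_bind_iff, PMF.mem_support_map_iff] at ha
    obtain ⟨x, hx, y, hy, rfl⟩ := ha
    -- The value after zero rounds is `v` itself, so the case `i = 0` of `h` bounds the input of the
    -- first round.
    have h1 := (hb _ _ hx).trans (b.eval_mono_nat (h 0 (Nat.zero_le _) v (by simp [iterP])))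
    have h2 := ih x.1 (fun i hi a ha => h (i + 1) (by omega) a (by
      simp only [iterP, PMF.mem_support_bind_iff]
      exact ⟨x.1, mem_support_out.2 ⟨x.2, hx⟩, ha⟩)) y hy
    simp only
    rw [Nat.succ_mul]
    omega

/-- A loop after an initialization is polynomial if the number of rounds and the intermediate
values are polynomially bounded. -/
theorem PPT.seq_loop {I P : Prog} (hI : I.PPT) (hP : P.PPT) (r B : Polynomial ℕ)
    (hr : ∀ v, ∀ a ∈ (I.out v).support, a.fst.num ≤ r.eval v.size)
    (hB : ∀ v, ∀ a ∈ (I.out v).support, ∀ j ≤ a.fst.num,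
      ∀ s ∈ (iterP P.out j a.snd).support, s.size ≤ B.eval v.size) :
    (Prog.seq I (loop P)).PPT := by
  obtain ⟨c, hc⟩ := hI
  obtain ⟨b, hb⟩ := hP
  -- The bound `c` occurs twice: for running `I`, and for reading the input of the loop, whose size
  -- is at most the cost of `I`.
  refine ⟨c + (c + r * (b.comp B + 1) + 1) + 1, fun v a ha => ?_⟩
  simp only [run, PMF.mem_support_bind_iff, PMF.mem_support_map_iff] at ha
  obtain ⟨x, hx, _, ⟨y, hy, rfl⟩, rfl⟩ := ha
  have h1 := hc _ _ hx
  have h2 := size_le_cost I _ _ hx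
  have hx' := mem_support_out.2 ⟨x.2, hx⟩
  have h3 := cost_iterate_le hb (B.eval v.size) _ _ (hB v x.1 hx') _ hy
  have h4 := h3.trans (Nat.mul_le_mul_right _ (hr v x.1 hx'))
  simp only [Polynomial.eval_add, Polynomial.eval_mul, Polynomial.eval_comp, Polynomial.eval_one]
  omega

end Prog

end AHSecAgg

namespace AHSecAgg

open Value

@[simp] theorem Value.fst_pair (a b : Value) : (pair a b).fst = a := rfl
@[simp] theorem Value.snd_pair (a b : Value) : (pair a b).snd = b := rfl
@[simp] theorem Value.fst_atom (a : ℕ) : (atom a).fst = atom 0 := rfl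
@[simp] theorem Value.snd_atom (a : ℕ) : (atom a).snd = atom 0 := rfl
@[simp] theorem Value.num_atom (a : ℕ) : (atom a).num = a := rfl
@[simp] theorem Value.num_pair (a b : Value) : (pair a b).num = 0 := rfl

/-! ### Folding over lists -/

/-- Fold of a random function over a list. -/
noncomputable def foldP {α β : Type} (f : β → α → PMF β) : List α → β → PMF β
  | [], b => PMF.pure b
  | a :: l, b => (f b a).bind (foldP f l)

/-- Independent random choices for the entries of a list. -/
noncomputable def mapP {α β : Type} (f : α → PMF β) : List α → PMF (List β)
  | [] => PMF.pure []
  | a :: l => (f a).bind fun b => (mapP f l).map (b :: ·)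

theorem foldP_pure {α β : Type} (f : β → α → β) (l : List α) (b : β) :
    foldP (fun b a => PMF.pure (f b a)) l b = PMF.pure (l.foldl f b) := by
  induction l generalizing b with
  | nil => rfl
  | cons a l ih => simp [foldP, ih]

theorem foldP_cons_map {α β : Type} (f : α → PMF β) (l : List α) (acc : List β) :
    foldP (fun acc a => (f a).map (· :: acc)) l acc =
      (mapP f l).map fun bs => bs.reverse ++ acc := by
  induction l generalizing acc with
  | nil => simp [foldP, mapP, PMF.pure_map]
  | cons a l ih =>
    simp only [foldP, mapP, PMF.bind_map, PMF.map_bind, PMF.map_comp]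
    congr 1
    funext b
    simp [ih, Function.comp_def]

/-- Applied with decoding maps as `φ` and `ψ`: a fold on codes becomes a fold on the data that they
represent. -/
theorem foldP_map {α β α' β' : Type} {f : β → α → PMF β} {g : β' → α' → PMF β'}
    {φ : α → α'} {ψ : β → β'} (h : ∀ b a, (f b a).map ψ = g (ψ b) (φ a)) (l : List α) (b : β) :
    (foldP f l b).map ψ = foldP g (l.map φ) (ψ b) := by
  induction l generalizing b with
  | nil => simp [foldP, PMF.pure_map]
  | cons a l ih =>
    simp only [foldP, List.map_cons, PMF.map_bind, ← h, PMF.bind_map]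
    congr 1
    funext x
    exact ih x

namespace Prog

/-- One round of a fold; the state consists of context, remaining list and accumulator. -/
def foldBody (Q : Prog) : Prog :=
  ite (seq snd (seq fst isAtom)) id
    (fork fst (fork (seq snd (seq fst snd))
      (seq (fork fst (fork (seq snd (seq fst fst)) (seq snd snd))) Q)))

/-- A loop over a list: on input (context, list, accumulator). -/
def fold (Q : Prog) : Prog :=
  seq (seq (fork (seq snd (seq fst size))
    (fork fst (fork (seq snd fst) (seq snd snd)))) (loop (foldBody Q))) (seq snd snd)

theorem out_id (v : Value) : id.out v = PMF.pure v := out_of_run_pure rfl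
theorem out_const (w v : Value) : (const w).out v = PMF.pure w := out_of_run_pure rfl
theorem out_fst (v : Value) : fst.out v = PMF.pure v.fst := out_of_run_pure rfl
theorem out_snd (v : Value) : snd.out v = PMF.pure v.snd := out_of_run_pure rfl
theorem out_size (v : Value) : size.out v = PMF.pure (atom v.size) := out_of_run_pure rfl
theorem out_isAtom (v : Value) :
    isAtom.out v = PMF.pure (match v with | .atom _ => .atom 1 | .pair _ _ => .atom 0) :=
  out_of_run_pure rfl
theorem out_eq (v : Value) : eq.out v = PMF.pure (ofBool (decide (v.fst = v.snd))) :=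
  out_of_run_pure rfl
theorem out_add (v : Value) : add.out v = PMF.pure (arith (· + ·) v) := out_of_run_pure rfl
theorem out_sub (v : Value) : sub.out v = PMF.pure (arith (· - ·) v) := out_of_run_pure rfl
theorem out_mul (v : Value) : mul.out v = PMF.pure (arith (· * ·) v) := out_of_run_pure rfl
theorem out_mod (v : Value) : mod.out v = PMF.pure (arith (· % ·) v) := out_of_run_pure rfl
theorem out_rand (v : Value) : rand.out v = (uniformBelow v.num).map atom := by
  simp only [out, run, PMF.map_comp]; rfl

/-- Once the list is exhausted the rounds are idle. Hence any upper bound for the length may serve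
as number of rounds, and `fold` takes the size of the list. -/
theorem out_foldBody_atom (Q : Prog) (c a : Value) (k : ℕ) :
    (foldBody Q).out (pair c (pair (atom k) a)) = PMF.pure (pair c (pair (atom k) a)) := by
  simp [foldBody, out_ite, out_seq, out_fst, out_snd, out_isAtom, out_id, Value.fst, Value.snd]

theorem out_foldBody_pair (Q : Prog) (c e r a : Value) :
    (foldBody Q).out (pair c (pair (pair e r) a)) =
      (Q.out (pair c (pair e a))).map fun a' => pair c (pair r a') := by
  simp [foldBody, out_ite, out_seq, out_fst, out_snd, out_isAtom, out_fork, Value.fst, Value.snd,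
    PMF.pure_map, PMF.map_comp, Function.comp_def]

theorem foldBody_ppt {Q : Prog} (h : Q.PPT) : (foldBody Q).PPT :=
  .ite (ppt_snd.seq (ppt_fst.seq ppt_isAtom)) ppt_id
    (ppt_fst.fork ((ppt_snd.seq (ppt_fst.seq ppt_snd)).fork
      ((ppt_fst.fork ((ppt_snd.seq (ppt_fst.seq ppt_fst)).fork (ppt_snd.seq ppt_snd))).seq h)))

theorem iterP_foldBody (Q : Prog) (c l a : Value) (j : ℕ) (hj : l.toList.length ≤ j) :
    (iterP (foldBody Q).out j (pair c (pair l a))).map (fun s => s.snd.snd) =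
      foldP (fun a e => Q.out (pair c (pair e a))) l.toList a := by
  induction l generalizing j a with
  | atom k =>
    have h : iterP (foldBody Q).out j (pair c (pair (atom k) a)) =
        PMF.pure (pair c (pair (atom k) a)) := by
      clear hj
      induction j with
      | zero => rfl
      | succ j ih => rw [iterP, out_foldBody_atom, PMF.pure_bind, ih]
    rw [h, PMF.pure_map]
    rfl
  | pair e r _ ih =>
    cases j with
    | zero => simp [toList] at hj
    | succ j =>
      rw [iterP, out_foldBody_pair, PMF.bind_map, PMF.map_bind]
      simp only [toList, foldP]
      congr 1
      funext a'
      exact ih a' j (by simpa [toList] using hj)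

theorem length_toList_lt_size (l : Value) : l.toList.length < l.size := by
  induction l with
  | atom => simp [toList, Value.size]
  | pair e r _ ih => simp [toList, Value.size]; omega

theorem out_fold (Q : Prog) (v : Value) :
    (fold Q).out v =
      foldP (fun a e => Q.out (pair v.fst (pair e a))) v.snd.fst.toList v.snd.snd := by
  have h := iterP_foldBody Q v.fst v.snd.fst v.snd.snd _ (length_toList_lt_size _).le
  rw [← h, fold, out_seq, out_seq]
  simp only [out_fork, out_seq, out_fst, out_snd, out_size, out_loop, PMF.pure_bind,
    PMF.pure_map, Value.snd_pair, Value.fst_pair, Value.num_atom]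
  congr 1
  funext s
  rw [out_seq, out_snd, PMF.pure_bind, out_snd]
  rfl

/-- Bounded growth of the accumulator of a fold. -/
def Growth (Q : Prog) : Prop :=
  ∃ b : Polynomial ℕ, ∀ c e a, ∀ a' ∈ (Q.out (pair c (pair e a))).support,
    a'.size ≤ a.size + b.eval (c.size + e.size)

/-- A polynomial body alone would not suffice, as it could double the accumulator in every round.
`Growth` allows an increment that depends on context and entry but not on the accumulator, so the
increments add up to a polynomial. -/
theorem fold_ppt {Q : Prog} (h : Q.PPT) (hQ : Growth Q) : (fold Q).PPT := by
  obtain ⟨b, hb⟩ := hQ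
  refine .seq (.seq_loop ((ppt_snd.seq (ppt_fst.seq ppt_size)).fork
    (ppt_fst.fork ((ppt_snd.seq ppt_fst).fork (ppt_snd.seq ppt_snd))))
    -- There are at most `v.size` rounds. The state has three components, each bounded by `v.size`
    -- up to the increments; an increment is at most `b` at `2 * v.size`, the bound for context and
    -- entry together.
    (foldBody_ppt h) .X (3 * (.X + 2) + 3 + .X * b.comp (2 * .X)) ?_ ?_) (ppt_snd.seq ppt_snd)
  · intro v a ha
    simp only [out_fork, out_seq, out_fst, out_snd, out_size, PMF.pure_bind, PMF.pure_map,
      PMF.mem_support_pure_iff] at ha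
    subst ha
    have := v.snd.size_fst_le
    have := v.size_snd_le
    simp only [Value.fst_pair, Value.num_atom, Polynomial.eval_X]
    omega
  · intro v x hx j hj
    simp only [out_fork, out_seq, out_fst, out_snd, out_size, PMF.pure_bind, PMF.pure_map,
      PMF.mem_support_pure_iff] at hx
    subst hx
    have h1 := v.snd.size_fst_le
    have h2 := v.size_snd_le
    have h3 := v.size_fst_le
    have h4 := v.snd.size_snd_le
    simp only [Value.fst_pair, Value.num_atom, Value.snd_pair] at hj ⊢
    generalize v.snd.fst = l at *
    generalize v.snd.snd = a at *
    -- Loop invariant: the context is fixed, the remaining list shrinks, and the accumulator has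
    -- received at most `j` increments.
    have key : ∀ s ∈ (iterP (foldBody Q).out j (pair v.fst (pair l a))).support,
        ∃ l' a' : Value, s = pair v.fst (pair l' a') ∧ l'.size ≤ l.size ∧
          a'.size ≤ a.size + j * b.eval (v.fst.size + l.size) := by
      clear hj
      induction j with
      | zero =>
        intro s hs
        simp only [iterP, PMF.mem_support_pure_iff] at hs
        exact ⟨l, a, hs, le_rfl, by simp⟩
      | succ j ih =>
        intro s hs
        rw [iterP_succ', PMF.mem_support_bind_iff] at hs
        obtain ⟨u, hu, hs⟩ := hs
        obtain ⟨l', a', rfl, hl, ha⟩ := ih u hu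
        rcases l' with k | ⟨e, r⟩
        · rw [out_foldBody_atom, PMF.mem_support_pure_iff] at hs
          refine ⟨_, _, hs, hl, ha.trans ?_⟩
          gcongr; omega
        · rw [out_foldBody_pair, PMF.mem_support_map_iff] at hs
          obtain ⟨a'', ha'', rfl⟩ := hs
          simp only [Value.size] at hl
          have := hb _ _ _ _ ha''
          have := b.eval_mono_nat (show v.fst.size + e.size ≤ v.fst.size + l.size by omega)
          refine ⟨r, a'', rfl, by omega, ?_⟩
          rw [Nat.succ_mul]
          omega
    intro s hs
    obtain ⟨l', a', rfl, hl, ha⟩ := key s hs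
    have h5 := b.eval_mono_nat (show v.fst.size + l.size ≤ 2 * v.size by omega)
    have h6 : j * b.eval (v.fst.size + l.size) ≤ v.size * b.eval (2 * v.size) :=
      Nat.mul_le_mul (by omega) h5
    simp [Value.size, Polynomial.eval_comp]
    omega

end Prog

end AHSecAgg

namespace AHSecAgg

open Value

/-! ### Polynomial-time random functions on coded data -/

/-- Data types whose elements are represented by values; every value can be read. -/
class Code (α : Type) where
  enc : α → Value
  dec : Value → α
  dec_enc : ∀ a, dec (enc a) = a

open Code

instance : Code Value := ⟨id, id, fun _ => rfl⟩
instance : Code ℕ := ⟨atom, num, fun _ => rfl⟩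
instance : Code Unit := ⟨fun _ => atom 0, fun _ => (), fun _ => rfl⟩
instance : Code Bool := ⟨ofBool, (decide <| · ≠ atom 0), fun b => by cases b <;> rfl⟩
instance {α β : Type} [Code α] [Code β] : Code (α × β) :=
  ⟨fun a => pair (enc a.1) (enc a.2), fun v => (dec v.fst, dec v.snd), fun a => by
    simp [dec_enc]⟩

theorem Value.toList_ofList (l : List Value) : (ofList l).toList = l := by
  induction l with
  | nil => rfl
  | cons a l ih => simp [ofList, toList, ih]

instance {α : Type} [Code α] : Code (List α) :=
  ⟨fun l => ofList (l.map enc), fun v => v.toList.map dec, fun l => by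
    simp [toList_ofList, Function.comp_def, dec_enc]⟩

instance {α : Type} [Code α] : Code (Option α) :=
  ⟨fun o => ofOption (o.map enc), fun v => (toOption v).map dec, fun o => by
    cases o <;> simp [ofOption, toOption, dec_enc]⟩

@[simp] theorem dec_value (v : Value) : (dec v : Value) = v := rfl
@[simp] theorem dec_nat (v : Value) : (dec v : ℕ) = v.num := rfl
@[simp] theorem dec_bool (v : Value) : (dec v : Bool) = decide (v ≠ atom 0) := rfl
@[simp] theorem dec_prod {α β : Type} [Code α] [Code β] (v : Value) :
    (dec v : α × β) = (dec v.fst, dec v.snd) := rfl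
@[simp] theorem dec_list {α : Type} [Code α] (v : Value) :
    (dec v : List α) = v.toList.map dec := rfl
@[simp] theorem dec_option {α : Type} [Code α] (v : Value) :
    (dec v : Option α) = (toOption v).map dec := rfl

variable {α β γ δ : Type} [Code α] [Code β] [Code γ] [Code δ]

/-- Random functions computed in polynomial time. -/
@[fun_prop]
def PT (f : α → PMF β) : Prop :=
  ∃ Q : Prog, Q.PPT ∧ ∀ v, (Q.out v).map dec = f (dec v)

/-- Functions computed in polynomial time. -/
@[fun_prop]
def PD (f : α → β) : Prop := PT fun a => PMF.pure (f a)

theorem Prog.PPT.pt {Q : Prog} (h : Q.PPT) : PT Q.out := ⟨Q, h, fun _ => PMF.map_id _⟩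

theorem PT.exists_prog {f : Value → PMF Value} (h : PT f) :
    ∃ Q : Prog, Q.PPT ∧ ∀ v, Q.out v = f v := by
  obtain ⟨Q, hQ, h⟩ := h
  exact ⟨Q, hQ, fun v => (PMF.map_id _).symm.trans (h v)⟩

theorem PD.of_out {Q : Prog} (hQ : Q.PPT) (F : Value → Value) {f : α → β}
    (h : ∀ v, Q.out v = PMF.pure (F v)) (hF : ∀ v, dec (F v) = f (dec v)) : PD f :=
  ⟨Q, hQ, fun v => by rw [h, PMF.pure_map, hF]⟩

/-- Forking with the identity keeps the context `c` available to the second program. -/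
theorem PT.bind {f : γ → PMF α} {g : γ → α → PMF β} (hf : PT f)
    (hg : PT fun u : γ × α => g u.1 u.2) : PT fun c => (f c).bind (g c) := by
  obtain ⟨P, hP, hf⟩ := hf
  obtain ⟨Q, hQ, hg⟩ := hg
  refine ⟨.seq (.fork .id P) Q, .seq (.fork Prog.ppt_id hP) hQ, fun v => ?_⟩
  change _ = (f (dec v)).bind (g (dec v))
  rw [Prog.out_seq, Prog.out_fork, Prog.out_id, PMF.pure_bind, PMF.bind_map, PMF.map_bind, ← hf,
    PMF.bind_map]
  congr 1
  funext a
  exact hg _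

/-- The output of the inner program need not be a canonical code. Since `PT` demands correctness on
every value, read through `dec`, the outer program may be applied to it directly. -/
theorem PT.comp {f : α → PMF β} {g : γ → α} (hf : PT f) (hg : PD g) : PT fun c => f (g c) := by
  obtain ⟨P, hP, hf⟩ := hf
  obtain ⟨Q, hQ, hg⟩ := hg
  refine ⟨.seq Q P, .seq hQ hP, fun v => ?_⟩
  rw [Prog.out_seq, PMF.map_bind]
  simp only [hf]
  have := congrArg (PMF.bind · f) (hg v)
  simpa [PMF.bind_map, Function.comp_def] using this

@[fun_prop]
theorem PD.comp {f : α → β} {g : γ → α} (hf : PD f) (hg : PD g) : PD fun c => f (g c) :=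
  PT.comp (f := fun a => PMF.pure (f a)) hf hg

theorem PD.pt {f : α → β} (hf : PD f) : PT fun a => PMF.pure (f a) := hf

theorem PT.map {f : γ → PMF α} {g : γ → α → β} (hf : PT f)
    (hg : PD fun u : γ × α => g u.1 u.2) : PT fun c => (f c).map (g c) :=
  PT.bind hf hg

@[fun_prop]
theorem PD.id' : PD fun a : α => a := .of_out Prog.ppt_id (fun v => v) Prog.out_id fun _ => rfl

@[fun_prop]
theorem PD.const (b : β) : PD fun _ : α => b :=
  .of_out (Prog.ppt_const (enc b)) (fun _ => enc b) (Prog.out_const _) fun _ => dec_enc b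

-- For a `PD` function only the decoded result is certain; the code produced may be random. Hence
-- the two components are decoded one after the other inside the distribution.
@[fun_prop]
theorem PD.prodMk {f : γ → α} {g : γ → β} (hf : PD f) (hg : PD g) : PD fun c => (f c, g c) := by
  obtain ⟨P, hP, hf⟩ := hf
  obtain ⟨Q, hQ, hg⟩ := hg
  refine ⟨.fork P Q, .fork hP hQ, fun v => ?_⟩
  change _ = PMF.pure (f (dec v), g (dec v))
  rw [Prog.out_fork, PMF.map_bind]
  simp only [PMF.map_comp]
  have h1 : ∀ a, PMF.map (dec ∘ fun b => pair a b) (Q.out v) =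
      PMF.pure ((dec a, g (dec v)) : α × β) := by
    intro a
    rw [show (dec ∘ fun b => pair a b : Value → α × β) = (fun y : β => ((dec a : α), y)) ∘ dec
      from rfl, ← PMF.map_comp, hg, PMF.pure_map]
  simp only [h1]
  rw [show (fun a : Value => PMF.pure ((dec a, g (dec v)) : α × β)) =
    (fun x : α => PMF.pure (x, g (dec v))) ∘ dec from rfl, ← PMF.bind_map, hf, PMF.pure_bind]

theorem PD.fst_prod : PD (Prod.fst : α × β → α) :=
  .of_out Prog.ppt_fst Value.fst Prog.out_fst fun _ => rfl

theorem PD.snd_prod : PD (Prod.snd : α × β → β) :=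
  .of_out Prog.ppt_snd Value.snd Prog.out_snd fun _ => rfl

@[fun_prop]
theorem PD.fst {f : γ → α × β} (hf : PD f) : PD fun c => (f c).1 := PD.fst_prod.comp hf

@[fun_prop]
theorem PD.snd {f : γ → α × β} (hf : PD f) : PD fun c => (f c).2 := PD.snd_prod.comp hf

/-- Functions of two arguments. -/
theorem PD.comp₂ {F : α → β → δ} (hF : PD fun u : α × β => F u.1 u.2) {f : γ → α} {g : γ → β}
    (hf : PD f) (hg : PD g) : PD fun c => F (f c) (g c) :=
  PD.comp (f := fun u : α × β => F u.1 u.2) hF (hf.prodMk hg)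

theorem PT.comp₂ {F : α → β → PMF δ} (hF : PT fun u : α × β => F u.1 u.2) {f : γ → α} {g : γ → β}
    (hf : PD f) (hg : PD g) : PT fun c => F (f c) (g c) :=
  PT.comp (f := fun u : α × β => F u.1 u.2) hF (hf.prodMk hg)

theorem PT.cond {b : γ → Bool} {f g : γ → PMF α} (hb : PD b) (hf : PT f) (hg : PT g) :
    PT fun c => bif b c then f c else g c := by
  obtain ⟨B, hB, hb⟩ := hb
  obtain ⟨P, hP, hf⟩ := hf
  obtain ⟨Q, hQ, hg⟩ := hg
  refine ⟨.ite B P Q, .ite hB hP hQ, fun v => ?_⟩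
  rw [Prog.out_ite, PMF.map_bind]
  have : (fun a => PMF.map dec (if a = atom 0 then Q.out v else P.out v)) =
      (fun b : Bool => bif b then f (dec v) else g (dec v)) ∘ dec := by
    funext a
    by_cases h : a = atom 0 <;> simp [h, hf, hg]
  rw [this, ← PMF.bind_map, hb, PMF.pure_bind]

@[fun_prop]
theorem PD.cond {b : γ → Bool} {f g : γ → α} (hb : PD b) (hf : PD f) (hg : PD g) :
    PD fun c => bif b c then f c else g c := by
  have := PT.cond hb hf hg
  have h : (fun c => bif b c then PMF.pure (f c) else PMF.pure (g c)) =
      fun c => PMF.pure (bif b c then f c else g c) := by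
    funext c; cases b c <;> rfl
  rwa [h] at this

/-! #### Values, numbers and truth values -/

@[fun_prop]
theorem PD.pair {f g : γ → Value} (hf : PD f) (hg : PD g) : PD fun c => Value.pair (f c) (g c) :=
  PD.comp₂ (F := Value.pair) (.of_out (F := fun v => Value.pair v.fst v.snd)
    (.fork Prog.ppt_fst Prog.ppt_snd) (fun v => by
      rw [Prog.out_fork, Prog.out_fst, Prog.out_snd, PMF.pure_bind, PMF.pure_map])
    fun _ => rfl) hf hg

@[fun_prop]
theorem PD.value_fst {f : γ → Value} (hf : PD f) : PD fun c => (f c).fst :=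
  PD.comp (f := Value.fst) (.of_out Prog.ppt_fst Value.fst Prog.out_fst fun _ => rfl) hf

@[fun_prop]
theorem PD.value_snd {f : γ → Value} (hf : PD f) : PD fun c => (f c).snd :=
  PD.comp (f := Value.snd) (.of_out Prog.ppt_snd Value.snd Prog.out_snd fun _ => rfl) hf

@[fun_prop]
theorem PD.num {f : γ → Value} (hf : PD f) : PD fun c => (f c).num :=
  PD.comp (f := Value.num) (.of_out Prog.ppt_id (fun v => v) Prog.out_id fun _ => rfl) hf

theorem PD.of_arith {Q : Prog} (hQ : Q.PPT) {F : ℕ → ℕ → ℕ}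
    (h : ∀ v, Q.out v = PMF.pure (arith F v)) {f g : γ → ℕ} (hf : PD f) (hg : PD g) :
    PD fun c => F (f c) (g c) :=
  PD.comp₂ (.of_out hQ _ h fun _ => rfl) hf hg

@[fun_prop]
theorem PD.add {f g : γ → ℕ} (hf : PD f) (hg : PD g) : PD fun c => f c + g c :=
  .of_arith Prog.ppt_add Prog.out_add hf hg

@[fun_prop]
theorem PD.sub {f g : γ → ℕ} (hf : PD f) (hg : PD g) : PD fun c => f c - g c :=
  .of_arith Prog.ppt_sub Prog.out_sub hf hg

@[fun_prop]
theorem PD.mul {f g : γ → ℕ} (hf : PD f) (hg : PD g) : PD fun c => f c * g c :=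
  .of_arith Prog.ppt_mul Prog.out_mul hf hg

@[fun_prop]
theorem PD.mod {f g : γ → ℕ} (hf : PD f) (hg : PD g) : PD fun c => f c % g c :=
  .of_arith Prog.ppt_mod Prog.out_mod hf hg

-- The identity program would fail here: a pair reads as the number `0` without being the leaf `atom
-- 0`. Adding `0` turns whatever code is given into a true leaf.
@[fun_prop]
theorem PD.atom {f : γ → ℕ} (hf : PD f) : PD fun c => Value.atom (f c) :=
  PD.comp (f := fun u : ℕ × ℕ => Value.atom (u.1 + u.2))
    (.of_out Prog.ppt_add (arith (· + ·)) Prog.out_add fun _ => rfl) (hf.prodMk (PD.const 0))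

/-- Comparison of values. -/
def beqV (a b : Value) : Bool := decide (a = b)

/-- Comparison of numbers. -/
def ltN (a b : ℕ) : Bool := decide (a < b)

@[fun_prop]
theorem PD.beqV {f g : γ → Value} (hf : PD f) (hg : PD g) : PD fun c => beqV (f c) (g c) :=
  PD.comp₂ (.of_out Prog.ppt_eq _ Prog.out_eq fun v => by
    simp only [AHSecAgg.beqV, ofBool, dec_bool, dec_prod, dec_value]
    split_ifs <;> simp_all) hf hg

@[fun_prop]
theorem PD.not {f : γ → Bool} (hf : PD f) : PD fun c => !f c := by
  have : (fun c => !f c) = fun c => bif f c then false else true := by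
    funext c; cases f c <;> rfl
  rw [this]
  fun_prop

@[fun_prop]
theorem PD.and {f g : γ → Bool} (hf : PD f) (hg : PD g) : PD fun c => f c && g c := by
  have : (fun c => f c && g c) = fun c => bif f c then g c else false := by
    funext c; cases f c <;> rfl
  rw [this]
  fun_prop

@[fun_prop]
theorem PD.ltN {f g : γ → ℕ} (hf : PD f) (hg : PD g) : PD fun c => ltN (f c) (g c) := by
  -- Truncated subtraction decides the order: `f c < g c` if and only if `g c - f c` is not `0`.
  have : (fun c => AHSecAgg.ltN (f c) (g c)) =
      fun c => !AHSecAgg.beqV (Value.atom (g c - f c)) (Value.atom 0) := by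
    funext c
    rw [AHSecAgg.ltN, AHSecAgg.beqV, ← decide_not]
    simp [Nat.sub_eq_zero_iff_le]
  rw [this]
  fun_prop

/-- Recognition of leaves. -/
def isAtomV : Value → Bool
  | .atom _ => true
  | .pair _ _ => false

@[fun_prop]
theorem PD.isAtomV {f : γ → Value} (hf : PD f) : PD fun c => isAtomV (f c) :=
  PD.comp (f := AHSecAgg.isAtomV) (.of_out Prog.ppt_isAtom _ Prog.out_isAtom fun v => by
    cases v <;> simp [AHSecAgg.isAtomV]) hf

/-! #### Optional values -/

@[fun_prop]
theorem PD.some {f : γ → α} (hf : PD f) : PD fun c => some (f c) := by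
  refine PD.comp (f := Option.some) (.of_out (Q := .fork (.const (Value.atom 1)) .id)
    (F := fun v => Value.pair (Value.atom 1) v) (.fork (Prog.ppt_const _) Prog.ppt_id)
    (fun v => ?_) fun _ => rfl) hf
  rw [Prog.out_fork, Prog.out_const, Prog.out_id, PMF.pure_bind, PMF.pure_map]

@[fun_prop]
theorem PD.isSome {f : γ → Option α} (hf : PD f) : PD fun c => (f c).isSome := by
  have : PD fun o : Option α => o.isSome := by
    refine .of_out (Q := .ite .isAtom (.const (Value.atom 0)) (.const (Value.atom 1)))
      (F := fun v => bif AHSecAgg.isAtomV v then Value.atom 0 else Value.atom 1)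
      (.ite Prog.ppt_isAtom (Prog.ppt_const _) (Prog.ppt_const _)) (fun v => ?_) fun v => ?_
    · cases v <;> simp [Prog.out_ite, Prog.out_isAtom, AHSecAgg.isAtomV, Prog.out_const]
    · cases v <;> simp [AHSecAgg.isAtomV, toOption]
  exact this.comp hf

theorem PD.get_or {f : γ → Option α} {d : α} (hf : PD f) : PD fun c => (f c).getD d := by
  have : PD fun o : Option α => o.getD d := by
    refine .of_out (Q := .ite .isAtom (.const (enc d)) .snd)
      (F := fun v => bif AHSecAgg.isAtomV v then enc d else v.snd)
      (.ite Prog.ppt_isAtom (Prog.ppt_const _) Prog.ppt_snd) (fun v => ?_) fun v => ?_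
    · cases v <;> simp [Prog.out_ite, Prog.out_isAtom, AHSecAgg.isAtomV, Prog.out_const,
        Prog.out_snd]
    · cases v <;> simp [AHSecAgg.isAtomV, toOption, dec_enc]
  exact this.comp hf

@[fun_prop]
theorem PD.getD {f : γ → Option α} {d : γ → α} (hf : PD f) (hd : PD d) :
    PD fun c => (f c).getD (d c) := by
  by_cases h : Nonempty γ
  · obtain ⟨c₀⟩ := h
    -- In the case `some` the default is irrelevant, so a constant one can be used there, as
    -- `PD.get_or` requires.
    have : (fun c => (f c).getD (d c)) =
        fun c => bif (f c).isSome then (f c).getD (d c₀) else d c := by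
      funext c; cases f c <;> rfl
    rw [this]
    have := hf.get_or (d := d c₀)
    fun_prop
  · have : (fun c => (f c).getD (d c)) = d := by
      funext c; exact (h ⟨c⟩).elim
    rwa [this]

theorem PT.elim {f : γ → Option α} {n : γ → PMF β} {s : γ → α → PMF β} (hf : PD f) (hn : PT n)
    (hs : PT fun u : γ × α => s u.1 u.2) : PT fun c => (f c).elim (n c) (s c) := by
  by_cases h : Nonempty α
  · obtain ⟨a₀⟩ := h
    -- The default `a₀` only makes the extraction total; it is never used in the branch where the
    -- option is `some`.
    have : (fun c => (f c).elim (n c) (s c)) =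
        fun c => bif (f c).isSome then s c ((f c).getD a₀) else n c := by
      funext c; cases f c <;> rfl
    rw [this]
    exact PT.cond (by fun_prop) (PT.comp₂ hs (by fun_prop) (by fun_prop)) hn
  · have : (fun c => (f c).elim (n c) (s c)) = n := by
      funext c
      cases f c with
      | none => rfl
      | some a => exact (h ⟨a⟩).elim
    rwa [this]

@[fun_prop]
theorem PD.elim {f : γ → Option α} {n : γ → β} {s : γ → α → β} (hf : PD f) (hn : PD n)
    (hs : PD fun u : γ × α => s u.1 u.2) : PD fun c => (f c).elim (n c) (s c) := by
  have := PT.elim (n := fun c => PMF.pure (n c)) (s := fun c a => PMF.pure (s c a)) hf hn hs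
  have h : (fun c => (f c).elim (PMF.pure (n c)) fun a => PMF.pure (s c a)) =
      fun c => PMF.pure ((f c).elim (n c) (s c)) := by
    funext c; cases f c <;> rfl
  rwa [h] at this

@[fun_prop]
theorem PD.toOption {f : γ → Value} (hf : PD f) : PD fun c => toOption (f c) :=
  PD.comp (f := Value.toOption) (.of_out Prog.ppt_id (fun v => v) Prog.out_id fun v => by
    cases v <;> simp [Value.toOption]) hf

theorem PT.out {Q : Prog} (hQ : Q.PPT) {f : γ → Value} (hf : PD f) : PT fun c => Q.out (f c) :=
  hQ.pt.comp hf

theorem PT.uniformBelow {f : γ → ℕ} (hf : PD f) : PT fun c => uniformBelow (f c) := by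
  refine PT.comp (f := AHSecAgg.uniformBelow) ⟨.rand, Prog.ppt_rand, fun v => ?_⟩ hf
  rw [Prog.out_rand, PMF.map_comp]
  exact PMF.map_id _

end AHSecAgg

namespace AHSecAgg

open Value Code

variable {α β γ δ : Type} [Code α] [Code β] [Code γ] [Code δ]

/-! #### Lists -/

theorem PT.foldP {Q : Prog} (hQ : Q.PPT) (hg : Prog.Growth Q) {f : γ → α → β → PMF β}
    (h : ∀ v, (Q.out v).map dec = f (dec v.fst) (dec v.snd.fst) (dec v.snd.snd)) :
    PT fun u : γ × List α × β => foldP (fun b a => f u.1 a b) u.2.1 u.2.2 := by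
  refine ⟨Prog.fold Q, Prog.fold_ppt hQ hg, fun v => ?_⟩
  rw [Prog.out_fold]
  exact foldP_map (fun b a => h _) _ _

theorem PD.foldl {Q : Prog} (hQ : Q.PPT) (hg : Prog.Growth Q) {f : γ → α → β → β}
    (h : ∀ v, (Q.out v).map dec = PMF.pure (f (dec v.fst) (dec v.snd.fst) (dec v.snd.snd)))
    {c : δ → γ} {l : δ → List α} {b : δ → β} (hc : PD c) (hl : PD l) (hb : PD b) :
    PD fun d => (l d).foldl (fun b a => f (c d) a b) (b d) := by
  have h1 := PT.foldP (f := fun c a b => PMF.pure (f c a b)) hQ hg h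
  have h2 := PT.comp h1 (hc.prodMk (hl.prodMk hb))
  simp only [foldP_pure] at h2
  exact h2

/-- Context and entry, for the body of a fold. -/
def Prog.foldArgs : Prog := .fork .fst (.seq .snd .fst)

/-- Accumulator, for the body of a fold. -/
def Prog.foldAcc : Prog := .seq .snd .snd

theorem Prog.foldArgs_ppt : Prog.foldArgs.PPT := .fork ppt_fst (.seq ppt_snd ppt_fst)

theorem Prog.foldAcc_ppt : Prog.foldAcc.PPT := .seq ppt_snd ppt_snd

theorem Prog.out_foldArgs (v : Value) :
    foldArgs.out v = PMF.pure (Value.pair v.fst v.snd.fst) := by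
  simp [foldArgs, out_fork, out_seq, out_fst, out_snd, PMF.pure_map]

theorem Prog.out_foldAcc (v : Value) : foldAcc.out v = PMF.pure v.snd.snd := by
  simp [foldAcc, out_seq, out_snd]

@[fun_prop]
theorem PD.cons {a : γ → α} {l : γ → List α} (ha : PD a) (hl : PD l) :
    PD fun c => a c :: l c :=
  PD.comp₂ (F := List.cons) (.of_out (F := fun v => Value.pair v.fst v.snd)
    (.fork Prog.ppt_fst Prog.ppt_snd) (fun v => by
      rw [Prog.out_fork, Prog.out_fst, Prog.out_snd, PMF.pure_bind, PMF.pure_map])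
    fun _ => rfl) ha hl

/-- The body of the fold that reverses a list. -/
def Prog.consBody : Prog := .fork (.seq .snd .fst) .foldAcc

theorem Prog.consBody_ppt : consBody.PPT := .fork (.seq ppt_snd ppt_fst) foldAcc_ppt

theorem Prog.out_consBody (v : Value) :
    consBody.out v = PMF.pure (Value.pair v.snd.fst v.snd.snd) := by
  simp [consBody, out_fork, out_seq, out_fst, out_snd, PMF.pure_map, out_foldAcc]

theorem Prog.consBody_growth : Growth consBody := by
  refine ⟨.X + 1, fun c e a a' h => ?_⟩
  rw [out_consBody, PMF.mem_support_pure_iff] at h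
  subst h
  simp [Value.size]
  omega

theorem foldl_cons_eq_reverse_append {α : Type} (l acc : List α) :
    l.foldl (fun b a => a :: b) acc = l.reverse ++ acc := by
  induction l generalizing acc with
  | nil => rfl
  | cons a l ih => simp [ih]

theorem PD.reverse_append {f g : γ → List α} (hf : PD f) (hg : PD g) :
    PD fun c => (f c).reverse ++ g c := by
  simp only [← foldl_cons_eq_reverse_append]
  refine PD.foldl (f := fun (_ : Unit) a b => a :: b) Prog.consBody_ppt Prog.consBody_growth
    (fun v => ?_) (PD.const ()) hf hg
  rw [Prog.out_consBody, PMF.pure_map]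
  rfl

@[fun_prop]
theorem PD.reverse {f : γ → List α} (hf : PD f) : PD fun c => (f c).reverse := by
  simpa using PD.reverse_append hf (PD.const [])

/-- The fold puts each result in front of the accumulator, which yields the reversed list; a final
reversal restores the order. The growth in a round is the output size of `Q` on context and entry,
so the accumulator does not matter. -/
theorem PT.mapP {f : γ → α → PMF β} {l : γ → List α} (hf : PT fun u : γ × α => f u.1 u.2)
    (hl : PD l) : PT fun c => mapP (f c) (l c) := by
  obtain ⟨Q, hQ, hf⟩ := hf
  have hQ' : (Prog.fork (.seq .foldArgs Q) .foldAcc).PPT :=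
    .fork (.seq Prog.foldArgs_ppt hQ) Prog.foldAcc_ppt
  have out : ∀ v, (Prog.fork (.seq .foldArgs Q) .foldAcc).out v =
      (Q.out (Value.pair v.fst v.snd.fst)).map fun b => Value.pair b v.snd.snd := by
    intro v
    simp only [Prog.out_fork, Prog.out_seq, Prog.out_foldArgs, Prog.out_foldAcc, PMF.pure_bind,
      PMF.pure_map]
    rfl
  have hg : Prog.Growth (.fork (.seq .foldArgs Q) .foldAcc) := by
    obtain ⟨b, hb⟩ := hQ.exists_size_bound
    refine ⟨b.comp (.X + 1) + 1, fun c e a a' h => ?_⟩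
    rw [out, PMF.mem_support_map_iff] at h
    obtain ⟨x, hx, rfl⟩ := h
    have := hb _ _ hx
    simp [Value.size, Polynomial.eval_comp] at this ⊢
    omega
  have h1 := PT.foldP (f := fun c a acc => (f c a).map (· :: acc)) hQ' hg fun v => by
    rw [out, PMF.map_comp]
    have := hf (Value.pair v.fst v.snd.fst)
    simp only [dec_prod, Value.fst_pair, Value.snd_pair] at this
    rw [← this, PMF.map_comp]
    rfl
  have h2 := PT.comp h1 (PD.prodMk PD.id' (hl.prodMk (PD.const [])))
  simp only [foldP_cons_map] at h2
  have h3 := PT.map (g := fun _ l => l.reverse) h2 (by fun_prop)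
  simpa [PMF.map_comp, Function.comp_def, PMF.map_id, ← Function.id_def] using h3

theorem mapP_pure {α β : Type} (f : α → β) (l : List α) :
    mapP (fun a => PMF.pure (f a)) l = PMF.pure (l.map f) := by
  induction l with
  | nil => rfl
  | cons a l ih => simp [mapP, ih, PMF.pure_map]

@[fun_prop]
theorem PD.map {f : γ → α → β} {l : γ → List α} (hf : PD fun u : γ × α => f u.1 u.2)
    (hl : PD l) : PD fun c => (l c).map (f c) := by
  have := PT.mapP (f := fun c a => PMF.pure (f c a)) hf hl
  simp only [mapP_pure] at this
  exact this

theorem foldl_filter_cons {α : Type} (p : α → Bool) (l acc : List α) :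
    l.foldl (fun b a => bif p a then a :: b else b) acc = (l.filter p).reverse ++ acc := by
  induction l generalizing acc with
  | nil => rfl
  | cons a l ih => cases h : p a <;> simp [ih, h]

@[fun_prop]
theorem PD.filter {p : γ → α → Bool} {l : γ → List α} (hp : PD fun u : γ × α => p u.1 u.2)
    (hl : PD l) : PD fun c => (l c).filter (p c) := by
  obtain ⟨Q, hQ, hp⟩ := hp
  have hQ' : (Prog.ite (.seq .foldArgs Q) .consBody .foldAcc).PPT :=
    .ite (.seq Prog.foldArgs_ppt hQ) Prog.consBody_ppt Prog.foldAcc_ppt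
  have out : ∀ v, (Prog.ite (.seq .foldArgs Q) .consBody .foldAcc).out v =
      PMF.pure (bif p (dec v.fst) (dec v.snd.fst) then Value.pair v.snd.fst v.snd.snd
        else v.snd.snd) := by
    intro v
    have h := hp (Value.pair v.fst v.snd.fst)
    simp only [dec_prod, Value.fst_pair, Value.snd_pair] at h
    rw [Prog.out_ite, Prog.out_seq, Prog.out_foldArgs, PMF.pure_bind, Prog.out_consBody,
      Prog.out_foldAcc]
    have h' : (fun a => if a = Value.atom 0 then PMF.pure v.snd.snd
          else PMF.pure (Value.pair v.snd.fst v.snd.snd)) =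
        (fun b : Bool => PMF.pure (bif b then Value.pair v.snd.fst v.snd.snd else v.snd.snd)) ∘
          dec := by
      funext a
      by_cases ha : a = Value.atom 0 <;> simp [ha]
    rw [h', ← PMF.bind_map, h, PMF.pure_bind]
  have hg : Prog.Growth (.ite (.seq .foldArgs Q) .consBody .foldAcc) := by
    refine ⟨.X + 1, fun c e a a' h => ?_⟩
    rw [out, PMF.mem_support_pure_iff] at h
    subst h
    simp only [Value.snd_pair, Value.fst_pair]
    cases p (dec c) (dec e) <;> simp [Value.size]
    omega
  have h1 := PD.foldl (f := fun c a acc => bif p c a then a :: acc else acc) hQ' hg (fun v => by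
    rw [out, PMF.pure_map]
    cases h : p (dec v.fst) (dec v.snd.fst) <;> simp [toList]) PD.id' hl (PD.const [])
  simp only [foldl_filter_cons] at h1
  simpa using h1.reverse

@[fun_prop]
theorem PD.head? {l : γ → List α} (hl : PD l) : PD fun c => (l c).head? := by
  refine PD.comp (f := List.head?) (.of_out
    (Q := .ite .isAtom (.const (Value.atom 0)) (.fork (.const (Value.atom 1)) .fst))
    (F := fun v => bif AHSecAgg.isAtomV v then Value.atom 0 else
      Value.pair (Value.atom 1) v.fst)
    (.ite Prog.ppt_isAtom (Prog.ppt_const _) (.fork (Prog.ppt_const _) Prog.ppt_fst))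
    (fun v => ?_) fun v => ?_) hl
  · cases v <;> simp [Prog.out_ite, Prog.out_isAtom, AHSecAgg.isAtomV, Prog.out_const,
      Prog.out_fork, Prog.out_fst, PMF.pure_map]
  · cases v <;> simp [AHSecAgg.isAtomV, Value.toOption, toList]

@[fun_prop]
theorem PD.find? {p : γ → α → Bool} {l : γ → List α} (hp : PD fun u : γ × α => p u.1 u.2)
    (hl : PD l) : PD fun c => (l c).find? (p c) := by
  have : (fun c => (l c).find? (p c)) = fun c => ((l c).filter (p c)).head? := by
    funext c; rw [List.head?_filter]
  rw [this]
  fun_prop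

@[fun_prop]
theorem PD.any {p : γ → α → Bool} {l : γ → List α} (hp : PD fun u : γ × α => p u.1 u.2)
    (hl : PD l) : PD fun c => (l c).any (p c) := by
  have : (fun c => (l c).any (p c)) = fun c => ((l c).find? (p c)).isSome := by
    funext c; rw [List.isSome_find?]
  rw [this]
  fun_prop

@[fun_prop]
theorem PD.all {p : γ → α → Bool} {l : γ → List α} (hp : PD fun u : γ × α => p u.1 u.2)
    (hl : PD l) : PD fun c => (l c).all (p c) := by
  have : (fun c => (l c).all (p c)) = fun c => !(l c).any fun a => !p c a := by
    funext c; rw [Bool.eq_iff_iff]; simp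
  rw [this]
  fun_prop

/-- The body of the fold that counts the entries of a list. -/
def Prog.countBody : Prog := .seq (.fork .foldAcc (.const (Value.atom 1))) .add

theorem Prog.countBody_ppt : countBody.PPT :=
  .seq (.fork foldAcc_ppt (ppt_const _)) ppt_add

theorem Prog.out_countBody (v : Value) :
    countBody.out v = PMF.pure (Value.atom (v.snd.snd.num + 1)) := by
  simp [countBody, out_seq, out_fork, out_foldAcc, out_const, out_add, arith, PMF.pure_map]

theorem Prog.countBody_growth : Growth countBody := by
  refine ⟨2, fun c e a a' h => ?_⟩
  rw [out_countBody, PMF.mem_support_pure_iff] at h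
  subst h
  have h1 := a.size_num_lt
  have h2 := Nat.size_add_le a.num 1
  simp [Value.size] at h2 ⊢
  omega

/-- The length of a list. -/
def Prog.length : Prog :=
  .seq (.fork (.const (Value.atom 0)) (.fork .id (.const (Value.atom 0)))) (fold countBody)

theorem Prog.length_ppt : Prog.length.PPT :=
  .seq (.fork (ppt_const _) (.fork ppt_id (ppt_const _))) (fold_ppt countBody_ppt countBody_growth)

theorem Prog.out_length (v : Value) :
    Prog.length.out v = PMF.pure (Value.atom v.toList.length) := by
  have h : ∀ (l : List Value) n,
      l.foldl (fun a _ => Value.atom (a.num + 1)) (Value.atom n) = Value.atom (n + l.length) := by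
    intro l
    induction l with
    | nil => simp
    | cons a l ih => intro n; simp [ih]; omega
  simp [Prog.length, out_seq, out_fork, out_const, out_id, out_fold, out_countBody, PMF.pure_map,
    foldP_pure, h]

@[fun_prop]
theorem PD.length {l : γ → List α} (hl : PD l) : PD fun c => (l c).length :=
  PD.comp (f := List.length) (.of_out Prog.length_ppt _ Prog.out_length fun v => by simp) hl

-- The body of this fold is itself a fold: it pushes an inner list, entry by entry, on the
-- accumulator. The result is the reversed concatenation.
@[fun_prop]
theorem PD.flatten {l : γ → List (List α)} (hl : PD l) : PD fun c => (l c).flatten := by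
  have out : ∀ v, (Prog.fold .consBody).out v =
      PMF.pure (v.snd.fst.toList.foldl (fun a e => Value.pair e a) v.snd.snd) := by
    intro v
    rw [Prog.out_fold]
    simp only [Prog.out_consBody, Value.snd_pair, Value.fst_pair]
    rw [foldP_pure]
  have hg : Prog.Growth (.fold .consBody) := by
    refine ⟨.X, fun c e a a' h => ?_⟩
    rw [out, PMF.mem_support_pure_iff] at h
    subst h
    simp only [Value.snd_pair, Value.fst_pair, Polynomial.eval_X]
    suffices ∀ a, (e.toList.foldl (fun a e => Value.pair e a) a).size ≤ a.size + e.size by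
      have := this a
      omega
    induction e with
    | atom => simp [toList]
    | pair x r _ ih =>
      intro a
      have := ih (Value.pair x a)
      simp [toList, Value.size] at this ⊢
      omega
  have h0 : ∀ (l : List Value) (a : Value),
      (l.foldl (fun a e => Value.pair e a) a).toList = l.reverse ++ a.toList := by
    intro l
    induction l with
    | nil => simp
    | cons e l ih => intro a; simp [ih, toList]
  have h1 := PD.foldl (f := fun (_ : Unit) (e a : List α) => e.reverse ++ a)
    (Prog.fold_ppt Prog.consBody_ppt Prog.consBody_growth) hg (fun v => by
      rw [out, PMF.pure_map]; simp [h0]) (PD.const ()) hl (PD.const [])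
  have h2 : ∀ (l : List (List α)) a,
      l.foldl (fun a e => e.reverse ++ a) a = l.flatten.reverse ++ a := by
    intro l
    induction l with
    | nil => simp
    | cons a l ih => intro n; simp [ih]
  simp only [h2] at h1
  simpa using h1.reverse

@[fun_prop]
theorem PD.flatMap {f : γ → α → List β} {l : γ → List α} (hf : PD fun u : γ × α => f u.1 u.2)
    (hl : PD l) : PD fun c => (l c).flatMap (f c) := by
  simp only [List.flatMap_def]
  fun_prop

theorem Value.size_iterate_snd_le (j : ℕ) (v : Value) : (Value.snd^[j] v).size ≤ v.size := by
  induction j generalizing v with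
  | zero => rfl
  | succ j ih => exact (ih _).trans v.size_snd_le

theorem Value.toList_iterate_snd (j : ℕ) (v : Value) :
    (Value.snd^[j] v).toList = v.toList.drop j := by
  induction j generalizing v with
  | zero => rfl
  | succ j ih =>
    rw [Function.iterate_succ_apply, ih]
    cases v <;> simp [toList]

@[fun_prop]
theorem PD.drop {i : γ → ℕ} {l : γ → List α} (hi : PD i) (hl : PD l) :
    PD fun c => (l c).drop (i c) := by
  -- The double truncated subtraction is the minimum of the index and the size of the list. The
  -- index is given in binary and may be exponentially large, while rounds beyond the length of the
  -- list have no effect on what is read.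
  let I : Prog := .fork (.seq (.fork .fst (.seq (.fork .fst (.seq .snd .size)) .sub)) .sub) .snd
  have hI : I.PPT := .fork (.seq (.fork Prog.ppt_fst (.seq (.fork Prog.ppt_fst
    (.seq Prog.ppt_snd Prog.ppt_size)) Prog.ppt_sub)) Prog.ppt_sub) Prog.ppt_snd
  have out : ∀ v, I.out v = PMF.pure
      (Value.pair (Value.atom (v.fst.num - (v.fst.num - v.snd.size))) v.snd) := by
    intro v
    simp [I, Prog.out_seq, Prog.out_fork, Prog.out_fst, Prog.out_snd, Prog.out_size, Prog.out_sub,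
      arith, PMF.pure_map]
  have hs : Prog.snd.out = fun v => PMF.pure v.snd := funext Prog.out_snd
  refine PD.comp₂ (F := List.drop) (.of_out (Q := .seq I (.loop .snd))
    (F := fun v => Value.snd^[v.fst.num - (v.fst.num - v.snd.size)] v.snd)
    (.seq_loop hI Prog.ppt_snd .X .X (fun v a ha => ?_) (fun v a ha j hj s hs' => ?_))
    (fun v => ?_) fun v => ?_) hi hl
  · rw [out, PMF.mem_support_pure_iff] at ha
    subst ha
    have := v.size_snd_le
    simp only [Value.fst_pair, Value.num_atom, Polynomial.eval_X]
    omega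
  · rw [out, PMF.mem_support_pure_iff] at ha
    subst ha
    rw [hs, Prog.iterP_pure, PMF.mem_support_pure_iff] at hs'
    subst hs'
    simpa using (Value.size_iterate_snd_le _ _).trans v.size_snd_le
  · rw [Prog.out_seq, out, PMF.pure_bind, Prog.out_loop, hs, Prog.iterP_pure]
    rfl
  · have := Prog.length_toList_lt_size v.snd
    simp only [dec_list, dec_prod, dec_nat, Value.toList_iterate_snd, List.map_drop]
    by_cases h : v.fst.num ≤ v.snd.size
    · congr 1; omega
    · rw [List.drop_eq_nil_of_le, List.drop_eq_nil_of_le] <;> simp <;> omega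

@[fun_prop]
theorem PD.listGetD {i : γ → ℕ} {l : γ → List α} {d : γ → α} (hl : PD l) (hi : PD i)
    (hd : PD d) : PD fun c => (l c).getD (i c) (d c) := by
  have : (fun c => (l c).getD (i c) (d c)) = fun c => ((l c).drop (i c)).head?.getD (d c) := by
    funext c; simp
  rw [this]
  fun_prop

/-- One round of counting down, on (counter, list). -/
def rangeStep (s : Value) : Value :=
  Value.pair (Value.atom (s.fst.num - 1)) (Value.pair (Value.atom (s.fst.num - 1)) s.snd)

/-- After `j` rounds the counter is `n - j` and the list runs from `n - j` to `n - 1`. The size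
bound gives `n + 2` to each entry and to the counter. -/
theorem rangeStep_iterate (n j : ℕ) (hj : j ≤ n) :
    (rangeStep^[j] (Value.pair (Value.atom n) (Value.atom 0))).fst = Value.atom (n - j) ∧
    ((rangeStep^[j] (Value.pair (Value.atom n) (Value.atom 0))).snd.toList.map Value.num =
      List.range' (n - j) j) ∧
    (rangeStep^[j] (Value.pair (Value.atom n) (Value.atom 0))).size ≤
      (j + 1) * (n + 2) + 1 := by
  induction j with
  | zero =>
    have := Nat.size_le_self n
    simp [toList, Value.size]
    omega
  | succ j ih =>
    obtain ⟨h1, h2, h3⟩ := ih (by omega)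
    rw [Function.iterate_succ_apply']
    generalize rangeStep^[j] (Value.pair (Value.atom n) (Value.atom 0)) = s at *
    refine ⟨?_, ?_, ?_⟩
    · simp [rangeStep, h1]; omega
    · simp only [rangeStep, Value.snd_pair, toList, h1, List.map_cons, h2, Value.num_atom]
      rw [List.range'_succ]
      have e : n - j = n - (j + 1) + 1 := by omega
      rw [e, Nat.add_sub_cancel]
    · have h4 := Nat.size_le_size (Nat.sub_le (n - j) 1)
      have h5 := Nat.size_le_self (n - j - 1)
      have h6 : s.fst.size + s.snd.size + 1 ≤ (j + 1) * (n + 2) + 1 := by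
        rcases s with k | ⟨a, b⟩
        · simp at h1
          simp [Value.size] at h3 ⊢
          nlinarith
        · exact h3
      rw [h1] at h6
      simp only [rangeStep, h1, Value.num_atom, Value.size] at h6 ⊢
      have h7 : (j + 1 + 1) * (n + 2) = (j + 1) * (n + 2) + (n + 2) := by ring
      omega

/-- The numbers below the length of a list. -/
def Prog.rangeLength : Prog :=
  .seq (.seq (.seq .length (.fork .id (.fork .id (.const (Value.atom 0)))))
    (.loop (.fork (.seq (.fork .fst (.const (Value.atom 1))) .sub)
      (.fork (.seq (.fork .fst (.const (Value.atom 1))) .sub) .snd)))) .snd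

theorem Prog.rangeLength_spec : rangeLength.PPT ∧ ∀ v, rangeLength.out v =
    PMF.pure (rangeStep^[v.toList.length]
      (Value.pair (Value.atom v.toList.length) (Value.atom 0))).snd := by
  have hb : (Prog.fork (.seq (.fork .fst (.const (Value.atom 1))) .sub)
      (.fork (.seq (.fork .fst (.const (Value.atom 1))) .sub) .snd)).out =
      fun v => PMF.pure (rangeStep v) := by
    funext v
    simp [rangeStep, out_fork, out_seq, out_fst, out_const, out_sub, out_snd, arith, PMF.pure_map]
  have hD : (Prog.seq (.fork .fst (.const (Value.atom 1))) .sub).PPT :=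
    .seq (.fork ppt_fst (ppt_const _)) ppt_sub
  have hI : ∀ v, (Prog.seq .length (.fork .id (.fork .id (.const (Value.atom 0))))).out v =
      PMF.pure (Value.pair (Value.atom v.toList.length)
        (Value.pair (Value.atom v.toList.length) (Value.atom 0))) := by
    intro v
    simp [out_fork, out_seq, out_length, out_id, out_const, PMF.pure_map]
  refine ⟨.seq (.seq_loop (.seq length_ppt (.fork ppt_id (.fork ppt_id (ppt_const _))))
    (.fork hD (.fork hD ppt_snd)) .X ((.X + 1) * (.X + 2) + 1) ?_ ?_) ppt_snd, fun v => ?_⟩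
  · intro v a ha
    rw [hI, PMF.mem_support_pure_iff] at ha
    subst ha
    simpa using (length_toList_lt_size v).le
  · intro v a ha j hj s hs
    rw [hI, PMF.mem_support_pure_iff] at ha
    subst ha
    rw [hb, iterP_pure, PMF.mem_support_pure_iff] at hs
    subst hs
    simp only [Value.fst_pair, Value.num_atom, Value.snd_pair] at hj ⊢
    have h1 := length_toList_lt_size v
    refine (rangeStep_iterate _ j hj).2.2.trans ?_
    simp only [Polynomial.eval_add, Polynomial.eval_mul, Polynomial.eval_X, Polynomial.eval_one,
      Polynomial.eval_ofNat]
    gcongr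
    all_goals omega
  · rw [rangeLength, out_seq, out_seq, hI, PMF.pure_bind, out_loop, hb, iterP_pure, PMF.pure_bind,
      out_snd]
    rfl

-- Ranges are formed only up to the length of a list: a range up to a number in binary can be
-- exponentially longer than its code.
@[fun_prop]
theorem PD.range_length {l : γ → List α} (hl : PD l) : PD fun c => List.range (l c).length :=
  PD.comp (f := fun l : List α => List.range l.length)
    (.of_out Prog.rangeLength_spec.1 _ Prog.rangeLength_spec.2 fun v => by
      have := (rangeStep_iterate v.toList.length _ le_rfl).2.1
      simp only [dec_list, List.length_map, List.range_eq_range']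
      rw [Nat.sub_self] at this
      exact this) hl

@[fun_prop]
theorem PD.toList {f : γ → Value} (hf : PD f) : PD fun c => (f c).toList :=
  PD.comp (f := Value.toList) (.of_out Prog.ppt_id (fun v => v) Prog.out_id fun v => by
    exact List.map_id _) hf

-- A code of a list may end in any leaf, whereas `ofList` ends in `atom 0`. Rebuilding the list from
-- `atom 0` gives the exact value.
@[fun_prop]
theorem PD.ofList {f : γ → List Value} (hf : PD f) : PD fun c => ofList (f c) := by
  have h1 : PD fun l : List Value => l.foldl (fun a e => Value.pair e a) (Value.atom 0) :=
    PD.foldl (f := fun (_ : Unit) e a => Value.pair e a) Prog.consBody_ppt Prog.consBody_growth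
      (fun v => by rw [Prog.out_consBody, PMF.pure_map]; rfl) (PD.const ()) PD.id' (PD.const _)
  have h2 : ∀ l : List Value,
      Value.ofList l = l.reverse.foldl (fun a e => Value.pair e a) (Value.atom 0) := by
    intro l
    rw [List.foldl_reverse]
    induction l with
    | nil => rfl
    | cons a l ih => simp [Value.ofList, ih]
  simp only [h2]
  exact h1.comp hf.reverse

@[fun_prop]
theorem PD.nth {f : γ → Value} {i : γ → ℕ} (hf : PD f) (hi : PD i) :
    PD fun c => Value.nth (f c) (i c) := by
  unfold Value.nth
  fun_prop

end AHSecAgg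

/-! ### Modular arithmetic, calls of the primitives, and reading of the public inputs -/

namespace AHSecAgg

open Value Code

variable {α β γ δ : Type} [Code α] [Code β] [Code γ] [Code δ]

/-- Folds with numerical accumulators of bounded growth. -/
theorem PD.foldl_nat {f : γ → α → ℕ → ℕ} (hf : PD fun u : γ × α × ℕ => f u.1 u.2.1 u.2.2)
    (b : Polynomial ℕ)
    (hb : ∀ (c e : Value) (n : ℕ),
      (f (dec c) (dec e) n).size ≤ n.size + b.eval (c.size + e.size))
    {c : δ → γ} {l : δ → List α} {n : δ → ℕ} (hc : PD c) (hl : PD l) (hn : PD n) :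
    PD fun d => (l d).foldl (fun m a => f (c d) a m) (n d) := by
  obtain ⟨Q, hQ, h⟩ := hf
  -- The addition of `0` makes the output a leaf. The bound `hb` speaks of the number only, and `Q`
  -- itself might return a large code of a small number.
  have hQ' : (Prog.seq (.fork (.const (Value.atom 0)) Q) .add).PPT :=
    .seq (.fork (Prog.ppt_const _) hQ) Prog.ppt_add
  have out : ∀ v, (Prog.seq (.fork (.const (Value.atom 0)) Q) .add).out v =
      PMF.pure (Value.atom (f (dec v.fst) (dec v.snd.fst) v.snd.snd.num)) := by
    intro v
    have h1 := congrArg (PMF.map Value.atom) (h v)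
    rw [PMF.map_comp, PMF.pure_map] at h1
    simp only [Prog.out_seq, Prog.out_fork, Prog.out_const, PMF.pure_bind,
      PMF.bind_map]
    refine Eq.trans ?_ h1
    rw [PMF.map]
    congr 1
    funext a
    simp [Prog.out_add, arith]
  have hg : Prog.Growth (.seq (.fork (.const (Value.atom 0)) Q) .add) := by
    refine ⟨b + 1, fun c e a a' h => ?_⟩
    rw [out, PMF.mem_support_pure_iff] at h
    subst h
    have h1 := hb c e a.num
    have h2 := a.size_num_lt
    simp only [Value.size, Value.fst_pair, Value.snd_pair, Polynomial.eval_add,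
      Polynomial.eval_one]
    omega
  exact PD.foldl hQ' hg (fun v => by rw [out, PMF.pure_map]; rfl) hc hl hn

/-- Evaluation of a polynomial modulo `p`. -/
def evalMod (p z : ℕ) (l : List ℕ) : ℕ := l.foldr (fun a m => (a + z * m) % p) 0

-- By Horner's rule a round multiplies by `z` and adds a coefficient, which lengthens the
-- accumulator by at most the bits of both and one more; reduction does not lengthen it.
@[fun_prop]
theorem PD.evalMod {p z : γ → ℕ} {l : γ → List ℕ} (hp : PD p) (hz : PD z) (hl : PD l) :
    PD fun c => evalMod (p c) (z c) (l c) := by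
  have := PD.foldl_nat (γ := ℕ × ℕ) (α := ℕ) (f := fun c a m => (a + c.2 * m) % c.1)
    (by fun_prop) (.X + 1) (fun c e m => by
      have h1 := Nat.size_le_size (Nat.mod_le (e.num + c.snd.num * m) c.fst.num)
      have h2 := Nat.size_add_le e.num (c.snd.num * m)
      have h3 := Nat.size_mul_le c.snd.num m
      have h4 := e.size_num_lt
      have h5 := c.snd.size_num_lt
      have h6 := c.size_snd_le
      simp only [dec_nat, dec_prod, Polynomial.eval_add, Polynomial.eval_X, Polynomial.eval_one]
      omega) (hp.prodMk hz) hl.reverse (PD.const 0)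
  simp only [List.foldl_reverse] at this
  exact this

attribute [fun_prop] PT.bind PT.map PT.cond PT.mapP PT.elim PT.out PT.uniformBelow PD.pt

theorem PT.thenRound {δ : Type} [Code δ] {a : γ → PMF (Value × Option α)}
    {f : γ → Value → α → PMF (Value × Option δ)} (ha : PT a)
    (hf : PT fun u : γ × Value × α => f u.1 u.2.1 u.2.2) :
    PT fun c => thenRound (a c) (f c) := by
  have : (fun c => AHSecAgg.thenRound (a c) (f c)) = fun c => (a c).bind fun b =>
      b.2.elim (PMF.pure (b.1, none)) (f c b.1) := by
    funext c
    rw [AHSecAgg.thenRound]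
    congr 1
    funext b
    rcases b with ⟨v, _ | s⟩ <;> rfl
  rw [this]
  refine PT.bind ha (PT.elim (by fun_prop) (PD.pt (by fun_prop)) ?_)
  exact PT.comp hf (g := fun u : (γ × Value × Option α) × α => (u.1.1, u.1.2.1, u.2))
    (by fun_prop)

theorem SignatureScheme.pd_verify (DS : SignatureScheme) {f g h : γ → Value} (hf : PD f)
    (hg : PD g) (hh : PD h) : PD fun c => DS.verify (f c) (g c) (h c) := by
  have : PD fun v : Value => DS.verify v.fst v.snd.fst v.snd.snd :=
    .of_out DS.verify_ppt _ DS.verify_computes fun v => by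
      cases h : DS.verify v.fst v.snd.fst v.snd.snd <;> simp [ofBool, h]
  exact this.comp (hf.pair (hg.pair hh))

theorem AEScheme.pd_dec (AE : AEScheme) {f g : γ → Value} (hf : PD f) (hg : PD g) :
    PD fun c => AE.dec (f c) (g c) := by
  have : PD fun v : Value => AE.dec v.fst v.snd :=
    .of_out AE.dec_ppt _ AE.dec_computes fun v => by
      cases h : AE.dec v.fst v.snd <;> simp [ofOption, h, toOption]
  exact this.comp (hf.pair hg)

attribute [fun_prop] SignatureScheme.pd_verify AEScheme.pd_dec PT.thenRound

/-! ### The simulator -/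

namespace Sim

/-! Reading the public inputs. -/

def secParam (v : Value) : Value := nth v 0
def corrupt (v : Value) : List Value := (nth v 1).toList
def threshold (v : Value) : ℕ := (nth v 2).num
def vecLength (v : Value) : Value := nth v 3
def modulus (v : Value) : ℕ := (nth v 4).num
def points (v : Value) : List Value := (nth v 5).toList
def group (v : Value) : Value := nth v 7
def generator (v : Value) : Value := nth v 8
def order (v : Value) : ℕ := (nth v 9).num
/-- The list of all users. -/
def users (v : Value) : List ℕ := List.range (corrupt v).length
/-- Whether a user is malicious. -/
def inC (v : Value) (i : ℕ) : Bool := !beqV ((corrupt v).getD i (atom 0)) (atom 0)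

/-- The entry number `i` of a table. -/
def at' (l : List Value) (i : ℕ) : Value := l.getD i (atom 0)

/-- Equality of numbers. -/
def eqN (a b : ℕ) : Bool := beqV (atom a) (atom b)

/-- Membership in a list of numbers. -/
def memN (i : ℕ) (U : List ℕ) : Bool := U.any fun j => eqN i j

/-- Removal from a list of numbers. -/
def eraseN (i : ℕ) (U : List ℕ) : List ℕ := U.filter fun j => !eqN j i

section

variable {v f g h : γ → Value} {i j : γ → ℕ} {l : γ → List Value} {U : γ → List ℕ}

@[fun_prop] theorem pd_secParam (hv : PD v) : PD fun c => secParam (v c) := by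
  unfold secParam; fun_prop
@[fun_prop] theorem pd_corrupt (hv : PD v) : PD fun c => corrupt (v c) := by
  unfold corrupt; fun_prop
@[fun_prop] theorem pd_threshold (hv : PD v) : PD fun c => threshold (v c) := by
  unfold threshold; fun_prop
@[fun_prop] theorem pd_vecLength (hv : PD v) : PD fun c => vecLength (v c) := by
  unfold vecLength; fun_prop
@[fun_prop] theorem pd_modulus (hv : PD v) : PD fun c => modulus (v c) := by
  unfold modulus; fun_prop
@[fun_prop] theorem pd_points (hv : PD v) : PD fun c => points (v c) := by
  unfold points; fun_prop
@[fun_prop] theorem pd_group (hv : PD v) : PD fun c => group (v c) := by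
  unfold group; fun_prop
@[fun_prop] theorem pd_generator (hv : PD v) : PD fun c => generator (v c) := by
  unfold generator; fun_prop
@[fun_prop] theorem pd_order (hv : PD v) : PD fun c => order (v c) := by
  unfold order; fun_prop
@[fun_prop] theorem pd_users (hv : PD v) : PD fun c => users (v c) := by
  unfold users; fun_prop
@[fun_prop] theorem pd_inC (hv : PD v) (hi : PD i) : PD fun c => inC (v c) (i c) := by
  unfold inC; fun_prop
@[fun_prop] theorem pd_at (hl : PD l) (hi : PD i) : PD fun c => at' (l c) (i c) := by
  unfold at'; fun_prop
@[fun_prop] theorem pd_eqN (hi : PD i) (hj : PD j) : PD fun c => eqN (i c) (j c) := by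
  unfold eqN; fun_prop
@[fun_prop] theorem pd_memN (hi : PD i) (hU : PD U) : PD fun c => memN (i c) (U c) := by
  unfold memN; fun_prop
@[fun_prop] theorem pd_eraseN (hi : PD i) (hU : PD U) : PD fun c => eraseN (i c) (U c) := by
  unfold eraseN; fun_prop

end

end Sim

end AHSecAgg

namespace AHSecAgg

open Value Code

/-! ### The server's bookkeeping and the rounds on coded data -/

namespace Sim

variable {α β γ δ : Type} [Code α] [Code β] [Code γ] [Code δ]

/-- What reaches the server from the user `i`; `h` is what an honest user sends. -/
def arrive (v w : Value) (i : ℕ) (h : Option Value) : Option Value :=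
  bif inC v i then toOption (nth w.snd.snd i)
  else bif !beqV (nth w.snd.fst i) (atom 0) then none else h

/-- The answer of the server to the messages; the table `ok` lists who sends well-formed
messages. -/
def accept (v : Value) (U : List ℕ) (msg : List (Option Value)) (ok : List Bool) :
    Option (List ℕ) :=
  bif !ltN (U.filter fun i => (msg.getD i none).isSome).length (threshold v) &&
      (U.filter fun i => (msg.getD i none).isSome).all fun i => ok.getD i false
  then some (U.filter fun i => (msg.getD i none).isSome) else none

/-- The messages received, with a default for missing ones. -/
def contents (msg : List (Option Value)) : List Value := msg.map fun o => o.getD (atom 0)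

/-- What the malicious users receive of a message of the server to all users in `U`. -/
def broadcast (v : Value) (U : List ℕ) (x : Value) : Value :=
  bif U.any (inC v) then pair (atom 1) x else atom 0

/-- A set of users as a message. -/
def setCode (U : List ℕ) : Value := ofList (U.map atom)

/-- The message `i ‖ j ‖ c`. -/
def head (i j : ℕ) (c : Value) : Value := pair (atom i) (pair (atom j) c)

/-- The entry `i ‖ j ‖ c ‖ σ` of a list, as the pair `(c, σ)`. -/
def lookup (i j : ℕ) (v : Value) : Value :=
  ((v.toList.find? fun e => beqV e.fst (atom i) && beqV e.snd.fst (atom j)).getD (atom 0)).snd.snd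

section

variable {v f g h w x : γ → Value} {i j : γ → ℕ} {l : γ → List Value} {U : γ → List ℕ}
  {o : γ → Option Value} {msg : γ → List (Option Value)} {ok : γ → List Bool}

@[fun_prop] theorem pd_arrive (hv : PD v) (hw : PD w) (hi : PD i) (ho : PD o) :
    PD fun c => arrive (v c) (w c) (i c) (o c) := by
  unfold arrive; fun_prop
@[fun_prop] theorem pd_accept (hv : PD v) (hU : PD U) (hm : PD msg) (hok : PD ok) :
    PD fun c => accept (v c) (U c) (msg c) (ok c) := by
  unfold accept; fun_prop
@[fun_prop] theorem pd_contents (hm : PD msg) : PD fun c => contents (msg c) := by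
  unfold contents; fun_prop
@[fun_prop] theorem pd_broadcast (hv : PD v) (hU : PD U) (hx : PD x) :
    PD fun c => broadcast (v c) (U c) (x c) := by
  unfold broadcast; fun_prop
@[fun_prop] theorem pd_setCode (hU : PD U) : PD fun c => setCode (U c) := by
  unfold setCode; fun_prop
@[fun_prop] theorem pd_head (hi : PD i) (hj : PD j) (hx : PD x) :
    PD fun c => head (i c) (j c) (x c) := by
  unfold head; fun_prop
@[fun_prop] theorem pd_lookup (hi : PD i) (hj : PD j) (hx : PD x) :
    PD fun c => lookup (i c) (j c) (x c) := by
  unfold lookup; fun_prop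

end

/-- Keys as a table: secret keys, public keys, and the keys of the server. -/
abbrev KeyTable := List Value × List Value × Value × Value

/-- State after round 0: users, agreed keys, public keys with signatures. -/
abbrev Table0 := List ℕ × List (List (Option Value)) × List Value × List Value

/-- State after round 1: users, who has not aborted, messages. -/
abbrev Table1 := List ℕ × List Bool × List Value

/-- State after round 2: users, who has not aborted, signature of the server. -/
abbrev Table2 := List ℕ × List Bool × Value

variable (DS : SignatureScheme) (AE : AEScheme) (DH : GroupFamily) (M : Prog)

/-- Key registration. -/
noncomputable def registration (v : Value) : PMF (Value × Option KeyTable) :=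
  (mapP (fun i => bif inC v i then PMF.pure (atom 0) else DS.gen.out (secParam v))
    (users v)).bind fun key =>
  (DS.gen.out (secParam v)).bind fun keyS =>
  (M.out (pair v (pair (ofList (key.map Value.snd)) keyS.snd))).bind fun w =>
  PMF.pure (pair (pair v (pair (ofList (key.map Value.snd)) keyS.snd)) w,
    some (key.map Value.fst,
      (users v).map fun i => bif inC v i then nth w.snd.snd i else (at' key i).snd,
      keyS.fst, keyS.snd))

theorem pt_registration (hM : M.PPT) : PT fun v => registration DS M v := by
  have := DS.gen_ppt
  unfold registration
  fun_prop (disch := assumption)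

/-- Key agreements. -/
noncomputable def round0 (v : Value) (K : KeyTable) (view : Value) :
    PMF (Value × Option Table0) :=
  (M.out view).bind fun w =>
  (mapP (fun i => bif inC v i then PMF.pure 0 else uniformBelow (order v)) (users v)).bind fun a =>
  (mapP (fun i => (DH.pow.out (pair (group v) (pair (generator v) (atom (a.getD i 0))))).map
    Value.snd) (users v)).bind fun com =>
  (mapP (fun i => bif inC v i then PMF.pure (atom 0)
    else DS.sign.out (pair (at' K.1 i) (at' com i))) (users v)).bind fun σ =>
  -- Binding to a point mass names a deterministic intermediate result in a form to which `PT.bind`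
  -- applies.
  PMF.bind (PMF.pure ((users v).map fun i => arrive v w i (some (pair (at' com i) (at' σ i)))))
    fun msg =>
  (accept v (users v) msg ((contents msg).map fun x => !isAtomV x)).elim
    (PMF.pure (pair view w, none)) fun U1 =>
  -- Powers are given by a program, so the agreed keys of all pairs are tabulated once; later rounds
  -- only look them up.
  (mapP (fun i => mapP (fun j => (DH.pow.out (pair (group v)
    (pair (at' (contents msg) j).fst (atom (a.getD i 0))))).map toOption) (users v))
      (users v)).bind fun agr =>
  PMF.pure (pair (pair view w) (broadcast v U1
      (ofList (U1.map fun i => pair (atom i) (at' (contents msg) i)))),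
    some (U1, agr, (contents msg).map Value.fst, (contents msg).map Value.snd))

/-- The key on which the users `i` and `j` have agreed. -/
def agreed (S : Table0) (i j : ℕ) : Option Value := (S.2.1.getD i []).getD j none

/-- The check of an honest user before key sharing. -/
def check1 (v : Value) (K : KeyTable) (S : Table0) (i : ℕ) : Bool :=
  (S.1.all fun j => DS.verify (at' S.2.2.2 j) (at' K.2.1 j) (at' S.2.2.1 j)) &&
  (ltN (threshold v) S.1.length &&
  ((S.1.all fun j => S.1.all fun l => !(beqV (at' S.2.2.1 j) (at' S.2.2.1 l) && !eqN j l)) &&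
  ((eraseN i S.1).all fun j => (agreed S i j).isSome)))

/-- The message of an honest user in the key sharing. -/
noncomputable def sharing (v : Value) (K : KeyTable) (S : Table0) (i : ℕ) : PMF Value :=
  (uniformBelow (modulus v)).bind fun s =>
  -- The threshold is given in binary, so the `t - 1` coefficients are drawn along a sublist of the
  -- users; since `t < n` it has exactly this length.
  (mapP (fun _ => uniformBelow (modulus v))
    ((users v).filter fun j => ltN j (threshold v - 1))).bind fun a =>
  (mapP (fun j => bif memN j (eraseN i S.1) then
      (AE.enc.out (pair ((agreed S i j).getD (atom 0))
        (atom (evalMod (modulus v) (at' (points v) j).num (s :: a))))).bind fun c =>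
      (DS.sign.out (pair (at' K.1 i) (head i j c))).bind fun σ =>
      PMF.pure (pair c σ)
    else PMF.pure (atom 0)) (users v)).bind fun cσ =>
  PMF.pure (ofList ((eraseN i S.1).map fun j => head i j (at' cσ j)))

/-- The format of the messages in the key sharing. -/
def wellFormed1 (U1 : List ℕ) (i : ℕ) (x : Value) : Bool :=
  -- The existence of suitable `c` and `σ` is decided by looking up the entries, rebuilding the
  -- message from them and comparing.
  beqV x (ofList ((eraseN i U1).map fun j =>
    head i j (pair (lookup i j x).fst (lookup i j x).snd)))

/-- Key sharing. -/
noncomputable def round1 (v : Value) (K : KeyTable) (S : Table0) (view : Value) :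
    PMF (Value × Option Table1) :=
  (M.out view).bind fun w =>
  (mapP (fun i => bif !inC v i && (memN i S.1 && check1 DS v K S i) then
      (sharing DS AE v K S i).map some
    else PMF.pure none) (users v)).bind fun h =>
  PMF.bind (PMF.pure ((users v).map fun i => arrive v w i (h.getD i none))) fun msg =>
  (accept v S.1 msg ((users v).map fun i => wellFormed1 S.1 i (at' (contents msg) i))).elim
    (PMF.pure (pair view w, none)) fun U2 =>
  PMF.pure (pair (pair view w) (broadcast v U2
      (ofList (U2.flatMap fun j => (at' (contents msg) j).toList))),
    some (U2, h.map Option.isSome, contents msg))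

/-- Whether the user `i` can open the share of the secret of `j`. -/
def opens (v : Value) (S0 : Table0) (S1 : Table1) (i j : ℕ) : Bool :=
  (agreed S0 i j).elim false fun key =>
    (AE.dec key (lookup j i (at' S1.2.2 j)).fst).elim false fun x =>
      isAtomV x && ltN x.num (modulus v)

/-- The check of an honest user before masking. -/
def check2 (v : Value) (K : KeyTable) (S0 : Table0) (S1 : Table1) (i : ℕ) : Bool :=
  (eraseN i S1.1).all fun j =>
    DS.verify (lookup j i (at' S1.2.2 j)).snd (at' K.2.1 j)
      (head j i (lookup j i (at' S1.2.2 j)).fst) && opens AE v S0 S1 i j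

/-- Recognition of vectors over the field. -/
def isVector (v x : Value) : Bool :=
  -- Agreement with its own reduction means that all entries are leaves below the modulus and that
  -- the list ends in `atom 0`. The length is compared in unary.
  beqV x (ofList (x.toList.map fun e => atom (e.num % modulus v))) &&
  beqV (ofList (x.toList.map fun _ => atom 1)) (vecLength v)

/-- Who masks an input in round 2. -/
def masks (v : Value) (K : KeyTable) (S0 : Table0) (S1 : Table1) (i : ℕ) : Bool :=
  !inC v i && (memN i S1.1 && (check2 DS AE v K S0 S1 i && S1.2.1.getD i false))

/-- Masking: honest messages are only recorded as present, as they pass all checks of the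
server. -/
noncomputable def round2 (v : Value) (K : KeyTable) (S0 : Table0) (S1 : Table1) (view : Value) :
    PMF (Value × Option Table2) :=
  (M.out view).bind fun w =>
  PMF.bind (PMF.pure ((users v).map fun i => arrive v w i
    (bif masks DS AE v K S0 S1 i then some (atom 0) else none))) fun msg =>
  (accept v S1.1 msg ((users v).map fun i => bif inC v i then
      !isAtomV (at' (contents msg) i) && isVector v (at' (contents msg) i).fst
    else true)).elim
    (PMF.pure (pair view w, none)) fun V =>
  PMF.bind (PMF.pure (V.filter fun i => bif inC v i then
      DS.verify (at' (contents msg) i).snd (at' K.2.1 i) (at' (contents msg) i).fst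
    else true)) fun U3 =>
  (DS.sign.out (pair K.2.2.1 (setCode U3))).bind fun σ4 =>
  PMF.pure (pair (pair view w) (broadcast v U3 (pair (setCode U3) σ4)),
    some (U3, (users v).map (masks DS AE v K S0 S1), σ4))

/-- Consistency check. -/
noncomputable def round3 (v : Value) (K : KeyTable) (S : Table2) (view : Value) :
    PMF (Value × Option Unit) :=
  (M.out view).bind fun w =>
  (mapP (fun i => bif !inC v i && (memN i S.1 && (S.2.1.getD i false &&
        DS.verify S.2.2 K.2.2.2 (setCode S.1))) then
      (DS.sign.out (pair (at' K.1 i) (setCode S.1))).map some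
    else PMF.pure none) (users v)).bind fun h =>
  PMF.bind (PMF.pure ((users v).map fun i => arrive v w i (h.getD i none))) fun msg =>
  (accept v S.1 msg ((users v).map fun _ => true)).elim
    (PMF.pure (pair view w, none)) fun U4 =>
  PMF.pure (pair (pair view w) (broadcast v U4
      (ofList (U4.map fun i => pair (atom i) (at' (contents msg) i)))), some ())

/-- Unmasking, in which the malicious users receive nothing. -/
noncomputable def round4 (view : Value) : PMF (Value × Option Unit) :=
  (M.out view).map fun w => (pair view w, none)

/-- The simulator: an execution without the inputs of the honest users. -/
noncomputable def simulate (v : Value) : PMF Value :=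
  (thenRound (registration DS M v) fun view K =>
   thenRound (round0 DS DH M v K view) fun view S0 =>
   thenRound (round1 DS AE M v K S0 view) fun view S1 =>
   thenRound (round2 DS AE M v K S0 S1 view) fun view S2 =>
   thenRound (round3 DS M v K S2 view) fun view _ =>
   round4 M view).map Prod.fst

/-! ### Polynomial step count of the simulator -/

section

variable {v view : γ → Value} {K : γ → KeyTable} {S0 : γ → Table0} {S1 : γ → Table1}
  {S2 : γ → Table2} {i j : γ → ℕ}

@[fun_prop]
theorem pt_round0 (hM : M.PPT) (hv : PD v) (hK : PD K) (hw : PD view) :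
    PT fun c => round0 DS DH M (v c) (K c) (view c) := by
  have := DS.sign_ppt
  have := DH.pow_ppt
  unfold round0
  fun_prop (disch := assumption)

@[fun_prop]
theorem pd_agreed (hS : PD S0) (hi : PD i) (hj : PD j) :
    PD fun c => agreed (S0 c) (i c) (j c) := by
  unfold agreed; fun_prop

@[fun_prop]
theorem pd_check1 (hv : PD v) (hK : PD K) (hS : PD S0) (hi : PD i) :
    PD fun c => check1 DS (v c) (K c) (S0 c) (i c) := by
  unfold check1; fun_prop

@[fun_prop]
theorem pt_sharing (hv : PD v) (hK : PD K) (hS : PD S0) (hi : PD i) :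
    PT fun c => sharing DS AE (v c) (K c) (S0 c) (i c) := by
  have := DS.sign_ppt
  have := AE.enc_ppt
  unfold sharing
  fun_prop (disch := assumption)

@[fun_prop]
theorem pd_wellFormed1 {U : γ → List ℕ} (hU : PD U) (hi : PD i) (hv : PD v) :
    PD fun c => wellFormed1 (U c) (i c) (v c) := by
  unfold wellFormed1; fun_prop

@[fun_prop]
theorem pt_round1 (hM : M.PPT) (hv : PD v) (hK : PD K) (hS : PD S0) (hw : PD view) :
    PT fun c => round1 DS AE M (v c) (K c) (S0 c) (view c) := by
  unfold round1
  fun_prop (disch := assumption)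

@[fun_prop]
theorem pd_opens (hv : PD v) (hS0 : PD S0) (hS1 : PD S1) (hi : PD i) (hj : PD j) :
    PD fun c => opens AE (v c) (S0 c) (S1 c) (i c) (j c) := by
  unfold opens; fun_prop

@[fun_prop]
theorem pd_check2 (hv : PD v) (hK : PD K) (hS0 : PD S0) (hS1 : PD S1) (hi : PD i) :
    PD fun c => check2 DS AE (v c) (K c) (S0 c) (S1 c) (i c) := by
  unfold check2; fun_prop

@[fun_prop]
theorem pd_isVector (hv : PD v) (hw : PD view) : PD fun c => isVector (v c) (view c) := by
  unfold isVector; fun_prop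

@[fun_prop]
theorem pd_masks (hv : PD v) (hK : PD K) (hS0 : PD S0) (hS1 : PD S1) (hi : PD i) :
    PD fun c => masks DS AE (v c) (K c) (S0 c) (S1 c) (i c) := by
  unfold masks; fun_prop

@[fun_prop]
theorem pt_round2 (hM : M.PPT) (hv : PD v) (hK : PD K) (hS0 : PD S0) (hS1 : PD S1)
    (hw : PD view) : PT fun c => round2 DS AE M (v c) (K c) (S0 c) (S1 c) (view c) := by
  have := DS.sign_ppt
  unfold round2
  fun_prop (disch := assumption)

@[fun_prop]
theorem pt_round3 (hM : M.PPT) (hv : PD v) (hK : PD K) (hS : PD S2) (hw : PD view) :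
    PT fun c => round3 DS M (v c) (K c) (S2 c) (view c) := by
  have := DS.sign_ppt
  unfold round3
  fun_prop (disch := assumption)

@[fun_prop]
theorem pt_round4 (hM : M.PPT) (hw : PD view) : PT fun c => round4 M (view c) := by
  unfold round4
  fun_prop (disch := assumption)

theorem pt_simulate (hM : M.PPT) : PT (simulate DS AE DH M) := by
  have := pt_registration DS M hM
  unfold simulate
  fun_prop (disch := assumption)

end

end Sim

end AHSecAgg

namespace AHSecAgg

open Value Code

/-! ### Families of independent samples -/

theorem pmf_bind_congr_support {α β : Type*} {p : PMF α} {f g : α → PMF β}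
    (h : ∀ a ∈ p.support, f a = g a) : p.bind f = p.bind g := by
  ext b
  rw [PMF.bind_apply, PMF.bind_apply]
  refine tsum_congr fun a => ?_
  by_cases ha : p a = 0
  · simp [ha]
  · rw [h a ((PMF.mem_support_iff _ _).2 ha)]

/-- The link between the lists of the simulator and the families of the protocol; both draw their
entries in the order of the index. -/
theorem mapP_ofFn {α β : Type} (f : α → PMF β) {n : ℕ} (g : Fin n → α) :
    mapP f (List.ofFn g) = (sampleAll n fun i => f (g i)).map List.ofFn := by
  induction n with
  | zero => simp [mapP, sampleAll, PMF.pure_map]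
  | succ n ih =>
    rw [List.ofFn_succ, mapP, sampleAll, PMF.map_bind]
    congr 1
    funext b
    rw [ih, PMF.map_comp, PMF.map_comp]
    congr 1
    funext l
    simp [List.ofFn_succ]

/-- Entrywise processing respects independent sampling. In this way data that the simulator does not
keep are discarded user by user. -/
theorem sampleAll_map {α β : Type} {n : ℕ} (f : Fin n → PMF α) (φ : Fin n → α → β) :
    (sampleAll n f).map (fun a i => φ i (a i)) = sampleAll n fun i => (f i).map (φ i) := by
  induction n with
  | zero =>
    rw [sampleAll, sampleAll, PMF.pure_map]
    congr 1
    funext i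
    exact i.elim0
  | succ n ih =>
    rw [sampleAll, sampleAll, PMF.map_bind, PMF.bind_map]
    congr 1
    funext a
    rw [Function.comp_apply, ← ih, PMF.map_comp, PMF.map_comp]
    congr 1
    funext b
    funext i
    refine Fin.cases ?_ (fun i => ?_) i <;> simp

theorem sampleAll_pure {α : Type} {n : ℕ} (f : Fin n → α) :
    sampleAll n (fun i => PMF.pure (f i)) = PMF.pure f := by
  induction n with
  | zero =>
    rw [sampleAll]
    congr 1
    funext i
    exact i.elim0
  | succ n ih =>
    rw [sampleAll, PMF.pure_bind, ih, PMF.pure_map]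
    congr 1
    exact Fin.cons_self_tail f

theorem mem_support_sampleAll {α : Type} {n : ℕ} {f : Fin n → PMF α} {a : Fin n → α}
    (h : a ∈ (sampleAll n f).support) (i : Fin n) : a i ∈ (f i).support := by
  induction n with
  | zero => exact i.elim0
  | succ n ih =>
    rw [sampleAll, PMF.mem_support_bind_iff] at h
    obtain ⟨x, hx, h⟩ := h
    rw [PMF.mem_support_map_iff] at h
    obtain ⟨b, hb, rfl⟩ := h
    refine Fin.cases ?_ (fun i => ?_) i
    · simpa using hx
    · simpa using ih hb i

/-- The protocol draws field elements, the simulator numbers; `ZMod.val` is a bijection onto the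
numbers below `p`. -/
theorem map_val_uniform (p : ℕ) [Fact p.Prime] :
    (PMF.uniformOfFintype (ZMod p)).map ZMod.val = uniformBelow p := by
  have hp : 0 < p := (Fact.out : p.Prime).pos
  have : NeZero p := ⟨hp.ne'⟩
  ext b
  rw [PMF.map_apply, uniformBelow, dif_pos hp]
  refine Eq.trans ?_ (PMF.uniformOfFinset_apply _ _).symm
  by_cases hb : b < p
  · rw [tsum_eq_single (b : ZMod p)]
    · simp [ZMod.val_natCast_of_lt hb, hb, ZMod.card]
    · intro a ha
      rw [if_neg]
      rintro rfl
      exact ha (ZMod.natCast_zmod_val a).symm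
  · rw [if_neg (by simpa using hb)]
    refine ENNReal.tsum_eq_zero.2 fun a => if_neg ?_
    rintro rfl
    exact hb (ZMod.val_lt a)

theorem evalMod_lt {p : ℕ} (hp : 0 < p) (z : ℕ) (l : List ℕ) : evalMod p z l < p := by
  cases l with
  | nil => exact hp
  | cons a l => exact Nat.mod_lt _ hp

theorem cast_evalMod {p : ℕ} [NeZero p] (z : ZMod p) {l : ℕ} (a : Fin l → ZMod p) :
    (evalMod p z.val (List.ofFn fun j => (a j).val) : ZMod p) =
      ∑ j : Fin l, a j * z ^ (j : ℕ) := by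
  induction l with
  | zero => simp [evalMod]
  | succ l ih =>
    have := ih fun j => a j.succ
    rw [evalMod] at this ⊢
    rw [List.ofFn_succ, List.foldr_cons, ZMod.natCast_mod, Nat.cast_add, Nat.cast_mul, this,
      Fin.sum_univ_succ, Finset.mul_sum]
    simp only [ZMod.natCast_val, ZMod.cast_id', id_eq, Fin.val_zero, pow_zero, mul_one,
      Fin.val_succ, pow_succ]
    congr 1
    exact Finset.sum_congr rfl fun j _ => by ring

/-- Both sides are below `p`, and Horner's rule for the whole coefficient vector `Fin.cons s a`
shows that they have the same residue. -/
theorem evalMod_share {p : ℕ} [NeZero p] (s z : ZMod p) {l : ℕ} (a : Fin l → ZMod p) :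
    evalMod p z.val (s.val :: List.ofFn fun j => (a j).val) = (share s a z).val := by
  have h := cast_evalMod z (Fin.cons s a : Fin (l + 1) → ZMod p)
  rw [List.ofFn_succ, Fin.sum_univ_succ] at h
  simp only [Fin.cons_zero, Fin.cons_succ, Fin.val_zero, pow_zero, mul_one, Fin.val_succ] at h
  rw [share, ← h, ZMod.val_natCast_of_lt (evalMod_lt (NeZero.pos p) _ _)]

/-! ### Tables -/

/-- A set of users as a list of numbers. -/
def ids {n : ℕ} (U : Finset (Fin n)) : List ℕ := (members U).map Fin.val

section

variable {n : ℕ} {α : Type}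

theorem mem_members {U : Finset (Fin n)} {i : Fin n} : i ∈ members U ↔ i ∈ U := by
  simp [members]

theorem members_nodup (U : Finset (Fin n)) : (members U).Nodup :=
  (List.nodup_finRange n).filter _

theorem length_ids (U : Finset (Fin n)) : (ids U).length = U.card := by
  rw [ids, List.length_map, ← List.toFinset_card_of_nodup (members_nodup U)]
  congr 1
  ext i
  simp [mem_members]

theorem all_ids (U : Finset (Fin n)) (p : ℕ → Bool) :
    (ids U).all p = decide (∀ i ∈ U, p i = true) := by
  rw [Bool.eq_iff_iff]
  simp [ids, mem_members]

theorem any_ids (U : Finset (Fin n)) (p : ℕ → Bool) :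
    (ids U).any p = decide (∃ i ∈ U, p i = true) := by
  rw [Bool.eq_iff_iff]
  simp [ids, mem_members]

theorem filter_ids (U : Finset (Fin n)) (p : ℕ → Bool) :
    (ids U).filter p = ids (U.filter fun i => p i = true) := by
  rw [ids, List.filter_map, ids, members, members, List.filter_filter]
  congr 1
  refine List.filter_congr fun i _ => ?_
  rw [Bool.eq_iff_iff]
  simp [and_comm]

theorem memN_ids (U : Finset (Fin n)) (i : Fin n) : Sim.memN i (ids U) = decide (i ∈ U) := by
  rw [Sim.memN, any_ids]
  simp [Sim.eqN, beqV, Fin.val_inj]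

theorem eraseN_ids (U : Finset (Fin n)) (i : Fin n) :
    Sim.eraseN i (ids U) = ids (U.erase i) := by
  rw [Sim.eraseN, filter_ids]
  congr 1
  ext j
  simp [Sim.eqN, beqV, Fin.val_inj, and_comm]

theorem getD_ofFn (f : Fin n → α) (i : Fin n) (d : α) : (List.ofFn f).getD i d = f i := by
  simp [List.getD]

theorem at_ofFn (f : Fin n → Value) (i : Fin n) : Sim.at' (List.ofFn f) i = f i :=
  getD_ofFn f i _

theorem map_ids (U : Finset (Fin n)) (f : ℕ → α) :
    (ids U).map f = (members U).map fun i : Fin n => f i := by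
  rw [ids, List.map_map]
  rfl

theorem range_eq_ofFn (n : ℕ) : List.range n = List.ofFn (Fin.val : Fin n → ℕ) :=
  List.ext_getElem (by simp) (by simp)

end

/-! ### The simulator's elementary operations on the actual public inputs -/

section

variable (DH : GroupFamily) (P : Params DH) (C : Finset (Fin P.n)) (aux : Value)

theorem Sim.secParam_publicVal : Sim.secParam (publicVal DH P C aux) = unary P.k := rfl
theorem Sim.threshold_publicVal : Sim.threshold (publicVal DH P C aux) = P.t := rfl
theorem Sim.vecLength_publicVal : Sim.vecLength (publicVal DH P C aux) = unary P.m := rfl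
theorem Sim.modulus_publicVal : Sim.modulus (publicVal DH P C aux) = P.p := rfl
theorem Sim.group_publicVal : Sim.group (publicVal DH P C aux) = DH.code P.d := rfl
theorem Sim.generator_publicVal : Sim.generator (publicVal DH P C aux) = DH.enc P.d P.g := rfl
theorem Sim.order_publicVal : Sim.order (publicVal DH P C aux) = P.q := rfl

theorem Sim.points_publicVal :
    Sim.points (publicVal DH P C aux) = List.ofFn fun i => fieldVal (P.X i) :=
  toList_ofList _

theorem Sim.corrupt_publicVal :
    Sim.corrupt (publicVal DH P C aux) = List.ofFn fun i => ofBool (decide (i ∈ C)) :=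
  toList_ofList _

theorem Sim.users_publicVal :
    Sim.users (publicVal DH P C aux) = List.ofFn (Fin.val : Fin P.n → ℕ) := by
  rw [Sim.users, Sim.corrupt_publicVal, List.length_ofFn, range_eq_ofFn]

theorem Sim.users_publicVal_eq_ids :
    Sim.users (publicVal DH P C aux) = ids (Finset.univ : Finset (Fin P.n)) := by
  rw [Sim.users_publicVal, ids, members]
  simp [List.ofFn_eq_map]

theorem Sim.inC_publicVal (i : Fin P.n) :
    Sim.inC (publicVal DH P C aux) i = decide (i ∈ C) := by
  rw [Sim.inC, Sim.corrupt_publicVal, getD_ofFn]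
  by_cases h : i ∈ C <;> simp [h, beqV, ofBool]

theorem Sim.mapP_users {β : Type} (f : ℕ → PMF β) :
    mapP f (Sim.users (publicVal DH P C aux)) =
      (sampleAll P.n fun i => f i).map List.ofFn := by
  rw [Sim.users_publicVal, mapP_ofFn]

theorem Sim.map_users {β : Type} (f : ℕ → β) :
    (Sim.users (publicVal DH P C aux)).map f = List.ofFn fun i : Fin P.n => f i := by
  rw [Sim.users_publicVal, List.map_ofFn]
  rfl

theorem Sim.arrive_publicVal (w : Value) (i : Fin P.n) (honest : Fin P.n → Option Value) :
    Sim.arrive (publicVal DH P C aux) w i (honest i) = sent C w honest i := by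
  rw [Sim.arrive, Sim.inC_publicVal, sent]
  by_cases h : i ∈ C
  · simp [h]
  · by_cases h' : nth w.snd.fst i = atom 0 <;> simp [h, dropped, beqV, h']

theorem Sim.broadcast_publicVal (U : Finset (Fin P.n)) (x : Value) :
    Sim.broadcast (publicVal DH P C aux) (ids U) x = deliver C U x := by
  rw [Sim.broadcast, any_ids, deliver]
  simp only [Sim.inC_publicVal, decide_eq_true_eq]
  have : (C ∩ U).Nonempty ↔ ∃ i ∈ U, i ∈ C := by
    simp only [Finset.Nonempty, Finset.mem_inter, and_comm]
  by_cases h : ∃ i ∈ U, i ∈ C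
  · rw [if_pos (this.2 h), decide_eq_true h]; rfl
  · rw [if_neg (mt this.1 h), decide_eq_false h]; rfl

theorem Sim.setCode_ids {n : ℕ} (U : Finset (Fin n)) : Sim.setCode (ids U) = setVal U := by
  rw [Sim.setCode, map_ids]; rfl

theorem Sim.contents_ofFn {n : ℕ} (msg : Fin n → Option Value) :
    Sim.contents (List.ofFn msg) = List.ofFn fun i => (msg i).getD (atom 0) := by
  rw [Sim.contents, List.map_ofFn]; rfl

/-- The server's decision depends only on who has sent something and whether it is well formed. So
the simulator may use a table `msg'` with placeholders instead of `msg`; round 2 needs this freedom.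
-/
theorem Sim.accept_publicVal (U : Finset (Fin P.n)) (msg msg' : Fin P.n → Option Value)
    (ok : Fin P.n → Bool) (WF : Fin P.n → Value → Prop)
    (h : ∀ i, (msg' i).isSome = (msg i).isSome)
    (hok : ∀ i ∈ U, ∀ x, msg i = some x → (ok i = true ↔ WF i x)) :
    Sim.accept (publicVal DH P C aux) (ids U) (List.ofFn msg') (List.ofFn ok) =
      (collect P.t U msg WF).map ids := by
  have hV : ((ids U).filter fun i => ((List.ofFn msg').getD i none).isSome) =
      ids (U.filter fun i => (msg i).isSome) := by
    rw [filter_ids]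
    simp only [getD_ofFn, h]
  rw [Sim.accept, hV, length_ids, all_ids, Sim.threshold_publicVal, collect]
  simp only [getD_ofFn, ltN]
  have : (!decide ((U.filter fun i => (msg i).isSome).card < P.t) &&
      decide (∀ i ∈ U.filter fun i => (msg i).isSome, ok i = true)) = true ↔
      (P.t ≤ (U.filter fun i => (msg i).isSome).card ∧
        ∀ i ∈ U.filter fun i => (msg i).isSome, ∀ v, msg i = some v → WF i v) := by
    rw [Bool.and_eq_true, decide_eq_true_iff, ← decide_not, decide_eq_true_iff, not_lt]
    refine and_congr_right fun _ => forall₂_congr fun i hi => ?_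
    rw [Finset.mem_filter] at hi
    obtain ⟨x, hx⟩ := Option.isSome_iff_exists.1 hi.2
    rw [hok i hi.1 x hx]
    constructor
    · intro hw v hv
      rw [hx] at hv
      cases hv
      exact hw
    · intro hw; exact hw x hx
  split_ifs with hc
  · have h1 := this.2 (by convert hc)
    rw [h1]
    simp
  · have h1 := mt this.1 (by intro h2; apply hc; convert h2)
    rw [Bool.not_eq_true] at h1
    rw [h1]
    simp

end

end AHSecAgg

namespace AHSecAgg

open Value Code

section

open scoped Classical

variable (DS : SignatureScheme) (AE : AEScheme) (DH : GroupFamily) (P : Params DH)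
variable (M : Prog) (C : Finset (Fin P.n)) (aux : Value)

/-! ### The simulated rounds -/

/-- The keys as a table. -/
def Keys.table {n : ℕ} (K : Keys n) : Sim.KeyTable :=
  (List.ofFn K.sk, List.ofFn K.pk, K.skS, K.pkS)

/-- The state after round 0 as seen by the simulator. -/
noncomputable def State0.table (S : State0 P.n) : Sim.Table0 :=
  (ids S.U1, List.ofFn fun i => List.ofFn fun j => agree DH P (S.comSk i) (S.comPk j),
    List.ofFn S.comPk, List.ofFn S.σ1)

/-- The state after round 1 as seen by the simulator. -/
def State1.table {n p : ℕ} (S : State1 n p) : Sim.Table1 :=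
  (ids S.U2, List.ofFn fun i => (S.secret i).isSome, List.ofFn S.content)

/-- The state after round 2 as seen by the simulator. -/
def State2.table {n m p : ℕ} (S : State2 n m p) : Sim.Table2 :=
  (ids S.U3, List.ofFn fun i => (S.held i).isSome, S.σ4)

theorem decide_cond {β : Type} (p : Prop) (h : Decidable p) (a b : β) :
    (bif @decide p h then a else b) = if p then a else b := by
  by_cases hp : p <;> simp [hp]

theorem pmf_bind_eq {α β : Type} (a : PMF α) (f : α → PMF β) : a >>= f = a.bind f := rfl
theorem Sim.registration_eq :
    Sim.registration DS M (publicVal DH P C aux) =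
      (AHSecAgg.registration DS DH P M C aux).map (Prod.map id (Option.map Keys.table)) := by
  rw [Sim.registration, AHSecAgg.registration, Sim.mapP_users, PMF.bind_map]
  simp only [pmf_bind_eq, PMF.map_bind, PMF.pure_map]
  simp only [Sim.inC_publicVal, decide_cond, Sim.secParam_publicVal, Function.comp_def,
    List.map_ofFn, Sim.map_users, at_ofFn]
  rfl

theorem pow_eq_agree (a : ℕ) (x : Value) :
    (DH.pow.out (pair (DH.code P.d) (pair x (atom a)))).map toOption =
      PMF.pure (agree DH P a x) := by
  rw [agree]
  split_ifs with h
  · have h' := h.choose_spec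
    conv_lhs => rw [← h', DH.pow_enc, PMF.pure_map]
    rfl
  · rw [DH.pow_error _ _ _ (by simpa using h), PMF.pure_map]
    rfl

theorem Sim.round0_eq (K : Keys P.n) (view : Value) :
    Sim.round0 DS DH M (publicVal DH P C aux) K.table view =
      (AHSecAgg.round0 DS DH P M C K view).map
        (Prod.map id (Option.map (State0.table DH P))) := by
  rw [Sim.round0, AHSecAgg.round0]
  simp only [pmf_bind_eq, PMF.map_bind, Sim.mapP_users, PMF.bind_map, PMF.pure_bind]
  congr 1
  funext w
  simp only [Sim.inC_publicVal, decide_cond, Sim.order_publicVal, Function.comp_def]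
  congr 1
  funext a
  -- Powers of the generator are computed with certainty, so this sample is a point mass.
  have hcom : (sampleAll P.n fun i => (DH.pow.out (pair (Sim.group (publicVal DH P C aux))
      (pair (Sim.generator (publicVal DH P C aux))
        (atom ((List.ofFn a).getD i 0))))).map Value.snd) =
      PMF.pure fun i => DH.enc P.d (P.g ^ a i) := by
    rw [← sampleAll_pure]
    congr 1
    funext i
    rw [Sim.group_publicVal, Sim.generator_publicVal, DH.pow_enc, PMF.pure_map, getD_ofFn]
    rfl
  rw [hcom, PMF.pure_bind]
  simp only [at_ofFn, Keys.table]
  congr 1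
  funext σ
  simp only [Sim.map_users, at_ofFn]
  have hm : (fun i : Fin P.n => Sim.arrive (publicVal DH P C aux) w i
      (some (pair (DH.enc P.d (P.g ^ a i)) (σ i)))) =
      sent C w fun i => some (pair (DH.enc P.d (P.g ^ a i)) (σ i)) := by
    funext i
    exact Sim.arrive_publicVal DH P C aux w i
      fun i => some (pair (DH.enc P.d (P.g ^ a i)) (σ i))
  rw [hm]
  generalize sent C w (fun i => some (pair (DH.enc P.d (P.g ^ a i)) (σ i))) = msg
  rw [Sim.contents_ofFn, List.map_ofFn, Sim.users_publicVal_eq_ids,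
    Sim.accept_publicVal DH P C aux _ msg msg _ (fun _ v => ∃ b c, v = pair b c) (fun _ => rfl)
      (fun i _ x hx => by
        simp only [Function.comp_apply, hx, Option.getD_some]
        cases x <;> simp [isAtomV])]
  cases collect P.t Finset.univ msg (fun _ v => ∃ b c, v = pair b c) with
  | none => simp [PMF.pure_map]
  | some U1 =>
    simp only [Option.map_some, Option.elim_some, PMF.pure_map, at_ofFn, getD_ofFn,
      Sim.group_publicVal, pow_eq_agree, sampleAll_pure, PMF.pure_bind, Sim.broadcast_publicVal,
      map_ids, List.map_ofFn]
    rfl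

theorem Sim.check1_eq (K : Keys P.n) (S : State0 P.n) (i : Fin P.n) :
    Sim.check1 DS (publicVal DH P C aux) K.table (S.table DH P) i =
      decide (Check1 DS DH P K S i) := by
  rw [Bool.eq_iff_iff, decide_eq_true_iff]
  simp only [Sim.check1, Sim.agreed, State0.table, Keys.table, all_ids, at_ofFn, getD_ofFn,
    eraseN_ids, length_ids, Sim.threshold_publicVal, ltN, Sim.eqN, beqV, Bool.and_eq_true,
    decide_eq_true_iff, Check1, Bool.not_eq_true', Bool.and_eq_false_iff, decide_eq_false_iff_not]
  refine and_congr_right fun _ => and_congr_right fun _ => and_congr_left fun _ => ?_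
  refine forall₂_congr fun j _ => forall₂_congr fun l _ => ?_
  simp [Fin.val_inj]
  tauto

/-- The messages of an honest user in round 1. -/
noncomputable def sharing (K : Keys P.n) (S0 : State0 P.n) (i : Fin P.n) :
    PMF ((ZMod P.p × (Fin P.n → ZMod P.p)) × Value) := do
  let s ← PMF.uniformOfFintype (ZMod P.p)
  let a ← sampleAll (P.t - 1) fun _ => PMF.uniformOfFintype (ZMod P.p)
  let sh : Fin P.n → ZMod P.p := fun j => share s a (P.X j)
  let cσ ← sampleAll P.n fun j =>
    if j ∈ S0.U1.erase i then do
      let key := (agree DH P (S0.comSk i) (S0.comPk j)).getD (atom 0)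
      let c ← AE.enc.out (pair key (fieldVal (sh j)))
      let σ ← DS.sign.out (pair (K.sk i) (header i j c))
      PMF.pure (pair c σ)
    else PMF.pure (atom 0)
  PMF.pure ((s, sh), ofList ((members (S0.U1.erase i)).map fun j => header i j (cσ j)))

/-- The honest user keeps the secret and its shares for later rounds; the simulator needs the
message only, hence the projection. -/
theorem Sim.sharing_eq (K : Keys P.n) (S : State0 P.n) (i : Fin P.n) :
    Sim.sharing DS AE (publicVal DH P C aux) K.table (S.table DH P) i =
      (AHSecAgg.sharing DS AE DH P K S i).map Prod.snd := by
  have : NeZero P.p := ⟨P.p_prime.ne_zero⟩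
  rw [Sim.sharing, AHSecAgg.sharing]
  simp only [pmf_bind_eq, PMF.map_bind, PMF.pure_map, Sim.modulus_publicVal, ← map_val_uniform,
    PMF.bind_map]
  congr 1
  funext s
  -- As `t < n`, the users with index below `t - 1` number exactly `t - 1`, one for each
  -- coefficient.
  have hl : ((Sim.users (publicVal DH P C aux)).filter fun j =>
      ltN j (Sim.threshold (publicVal DH P C aux) - 1)) =
      List.ofFn (Fin.val : Fin (P.t - 1) → ℕ) := by
    rw [Sim.users_publicVal, ← range_eq_ofFn, ← range_eq_ofFn, Sim.threshold_publicVal]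
    have h1 := P.t_lt_n
    obtain ⟨d, hd⟩ : ∃ d, P.n = P.t - 1 + d := ⟨P.n - (P.t - 1), by omega⟩
    rw [hd, List.range_add, List.filter_append, List.filter_eq_self.2, List.filter_eq_nil_iff.2,
      List.append_nil]
    · simp [ltN]
      omega
    · simp [ltN]
  rw [Function.comp_apply, hl, mapP_ofFn, ← sampleAll_map, PMF.bind_map, PMF.bind_map]
  congr 1
  funext a
  simp only [Function.comp_apply, Sim.mapP_users, PMF.bind_map, Sim.points_publicVal,
    State0.table, eraseN_ids, memN_ids, decide_cond, Sim.agreed, getD_ofFn, Sim.at', Keys.table,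
    fieldVal, Value.num_atom, evalMod_share, map_ids]
  refine congr_arg₂ PMF.bind rfl (funext fun c => ?_)
  simp only [Function.comp_apply, getD_ofFn]
  rfl

theorem find?_map_header {n : ℕ} (i j : Fin n) (l : List (Fin n)) (f : Fin n → Value)
    (hj : j ∈ l) :
    (l.map fun j => header i j (f j)).find?
      (fun e => decide (e.fst = idVal i ∧ e.snd.fst = idVal j)) = some (header i j (f j)) := by
  induction l with
  | nil => simp at hj
  | cons k l ih =>
    by_cases h : k = j
    · subst h; simp [header]
    · rw [List.map_cons, List.find?_cons_of_neg]
      · exact ih (by simpa [Ne.symm h] using hj)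
      · simp [header, idVal, Fin.val_inj, h]

theorem Sim.lookup_eq {n : ℕ} (i j : Fin n) (x : Value) : Sim.lookup i j x = entry i j x := by
  simp only [Sim.lookup, entry, beqV, Bool.decide_and]
  rfl

/-- If a message has the required form, looking up its headers returns the very pairs it was built
from, because different recipients have different headers. -/
theorem Sim.wellFormed1_iff (U : Finset (Fin P.n)) (i : Fin P.n) (x : Value) :
    Sim.wellFormed1 (ids U) i x = true ↔ ∃ c σ : Fin P.n → Value,
      x = ofList ((members (U.erase i)).map fun j => header i j (pair (c j) (σ j))) := by
  rw [Sim.wellFormed1, beqV, decide_eq_true_iff, eraseN_ids, map_ids]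
  simp only [Sim.lookup_eq]
  constructor
  · intro h
    exact ⟨_, _, h⟩
  · rintro ⟨c, σ, h⟩
    refine h.trans (congrArg ofList (List.map_congr_left fun j hj => ?_))
    have : entry i j x = pair (c j) (σ j) := by
      rw [entry, h, toList_ofList, find?_map_header i j _ (fun j => pair (c j) (σ j)) hj]
      rfl
    rw [this]
    rfl

theorem Sim.round1_eq (K : Keys P.n) (S : State0 P.n) (view : Value) :
    Sim.round1 DS AE M (publicVal DH P C aux) K.table (S.table DH P) view =
      (AHSecAgg.round1 DS AE DH P M C K S view).map
        (Prod.map id (Option.map State1.table)) := by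
  rw [Sim.round1, AHSecAgg.round1]
  simp only [pmf_bind_eq, PMF.map_bind, Sim.mapP_users, PMF.bind_map, PMF.pure_bind]
  congr 1
  funext w
  -- The messages of the simulator are those of the protocol with the secrets and shares forgotten,
  -- user by user.
  have hs : (sampleAll P.n fun i => bif !Sim.inC (publicVal DH P C aux) i &&
        (Sim.memN i (S.table DH P).1 && Sim.check1 DS (publicVal DH P C aux) K.table
          (S.table DH P) i) then
      (Sim.sharing DS AE (publicVal DH P C aux) K.table (S.table DH P) i).map some
    else PMF.pure none) =
      (sampleAll P.n fun i => if i ∉ C ∧ i ∈ S.U1 ∧ Check1 DS DH P K S i then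
        (AHSecAgg.sharing DS AE DH P K S i).map some else PMF.pure none).map
          fun h i => (h i).map Prod.snd := by
    rw [sampleAll_map]
    congr 1
    funext i
    rw [Sim.check1_eq, Sim.inC_publicVal, Sim.sharing_eq]
    simp only [State0.table, memN_ids, ← Bool.decide_and, ← decide_not, decide_cond]
    split_ifs
    · rw [PMF.map_comp, PMF.map_comp]; rfl
    · rw [PMF.pure_map]; rfl
  rw [hs, PMF.bind_map]
  refine congr_arg₂ PMF.bind ?_ (funext fun h => ?_)
  · congr 1
    funext i
    split_ifs
    · simp only [AHSecAgg.sharing, pmf_bind_eq, PMF.map_bind, PMF.pure_map]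
    · rfl
  simp only [Function.comp_apply, Sim.map_users, getD_ofFn]
  have hm : (fun i : Fin P.n => Sim.arrive (publicVal DH P C aux) w i
      ((h i).map Prod.snd)) = sent C w fun i => (h i).map Prod.snd := by
    funext i
    exact Sim.arrive_publicVal DH P C aux w i fun i => (h i).map Prod.snd
  rw [hm]
  generalize sent C w (fun i => (h i).map Prod.snd) = msg
  simp only [Sim.contents_ofFn, at_ofFn]
  rw [show (S.table DH P).1 = ids S.U1 from rfl,
    Sim.accept_publicVal DH P C aux _ msg msg _ _ (fun _ => rfl) fun i _ x hx => by
      rw [Sim.wellFormed1_iff, hx, Option.getD_some]]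
  cases collect P.t S.U1 msg (fun i v => ∃ c σ : Fin P.n → Value,
      v = ofList ((members (S.U1.erase i)).map fun j => header i j (pair (c j) (σ j)))) with
  | none => simp [PMF.pure_map]
  | some U2 =>
    simp only [Option.map_some, Option.elim_some, PMF.pure_map, Sim.broadcast_publicVal,
      List.map_ofFn]
    have : (ids U2).flatMap (fun j => (Sim.at' (List.ofFn fun i => (msg i).getD (atom 0)) j).toList)
        = (members U2).flatMap fun j => ((msg j).getD (atom 0)).toList := by
      rw [List.flatMap_def, map_ids]
      simp only [at_ofFn]
      rfl
    rw [this]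
    simp only [Prod.map, Option.map_some, State1.table, Option.isSome_map, Function.comp_def, id]

end

end AHSecAgg

namespace AHSecAgg

open Value Code

/-! ### Rounds 2 to 4, where private inputs enter, and the whole execution -/

section

open scoped Classical

variable (DS : SignatureScheme) (AE : AEScheme) (DH : GroupFamily) (P : Params DH)
variable (M : Prog) (C : Finset (Fin P.n)) (aux : Value)

/-- The keys of the honest users have been generated honestly. -/
def Keys.Honest (K : Keys P.n) : Prop :=
  ∀ i ∉ C, ∃ key ∈ (DS.gen.out (unary P.k)).support, K.sk i = key.fst ∧ K.pk i = key.snd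

theorem honest_of_mem_support_registration {view : Value} {K : Keys P.n}
    (h : (view, some K) ∈ (registration DS DH P M C aux).support) :
    Keys.Honest DS DH P C K := by
  rw [registration] at h
  simp only [pmf_bind_eq, PMF.mem_support_bind_iff, PMF.mem_support_pure_iff] at h
  obtain ⟨key, hkey, keyS, -, w, -, h⟩ := h
  obtain rfl := Option.some.inj (Prod.ext_iff.1 h).2
  intro i hi
  have := mem_support_sampleAll hkey i
  rw [if_neg hi] at this
  exact ⟨key i, this, rfl, if_neg hi⟩

theorem Sim.opens_eq (S0 : State0 P.n) (S1 : State1 P.n P.p) (i j : Fin P.n) :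
    Sim.opens AE (publicVal DH P C aux) (S0.table DH P) S1.table i j =
      (openShare AE DH P S0 S1 i j).isSome := by
  rw [Sim.opens, openShare]
  simp only [Sim.agreed, State0.table, State1.table, getD_ofFn, at_ofFn, Sim.lookup_eq,
    Sim.modulus_publicVal]
  cases agree DH P (S0.comSk i) (S0.comPk j) with
  | none => rfl
  | some key =>
    simp only [Option.elim_some, Option.bind_eq_bind, Option.bind_some]
    cases AE.dec key (entry j i (S1.content j)).fst with
    | none => rfl
    | some x =>
      cases x with
      | pair _ _ => rfl
      | atom a => by_cases h : a < P.p <;> simp [isAtomV, readField, ltN, h]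

theorem Sim.check2_eq (K : Keys P.n) (S0 : State0 P.n) (S1 : State1 P.n P.p) (i : Fin P.n) :
    Sim.check2 DS AE (publicVal DH P C aux) K.table (S0.table DH P) S1.table i =
      decide (Check2 DS AE DH P K S0 S1 i) := by
  rw [Sim.check2, Bool.eq_iff_iff, decide_eq_true_iff, Check2,
    show S1.table.1 = ids S1.U2 from rfl, eraseN_ids, all_ids, decide_eq_true_iff]
  simp only [Sim.opens_eq, Sim.lookup_eq, Bool.and_eq_true]
  simp only [Keys.table, State1.table, at_ofFn]
  rfl

theorem Sim.masks_eq (K : Keys P.n) (S0 : State0 P.n) (S1 : State1 P.n P.p) (i : Fin P.n) :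
    Sim.masks DS AE (publicVal DH P C aux) K.table (S0.table DH P) S1.table i =
      decide ((i ∉ C ∧ i ∈ S1.U2 ∧ Check2 DS AE DH P K S0 S1 i) ∧ (S1.secret i).isSome) := by
  rw [Sim.masks, Sim.check2_eq, Sim.inC_publicVal]
  simp only [State1.table, memN_ids, getD_ofFn]
  rw [Bool.eq_iff_iff]
  simp [and_assoc]

theorem unary_eq_iff (l : List Value) (m : ℕ) :
    ofList (l.map fun _ => atom 1) = unary m ↔ l.length = m := by
  constructor
  · intro h
    have := congrArg (fun v => v.toList.length) h
    simpa [unary, toList_ofList] using this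
  · rintro rfl
    rw [unary, List.map_const']

theorem beqV_iff (a b : Value) : beqV a b = true ↔ a = b := decide_eq_true_iff

theorem Sim.isVector_iff (x : Value) :
    Sim.isVector (publicVal DH P C aux) x = true ↔
      ∃ y : Fin P.m → ZMod P.p, x = vecVal y := by
  have hp : P.p ≠ 0 := P.p_prime.ne_zero
  have : NeZero P.p := ⟨hp⟩
  simp only [Sim.isVector, Bool.and_eq_true, beqV_iff, Sim.modulus_publicVal,
    Sim.vecLength_publicVal, unary_eq_iff]
  constructor
  · rintro ⟨h1, h2⟩
    refine ⟨fun l => ((x.toList[l.val]'(by omega)).num : ZMod P.p), h1.trans ?_⟩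
    rw [vecVal]
    congr 1
    refine List.ext_getElem (by simpa using h2) fun i _ _ => ?_
    simp [fieldVal, ZMod.val_natCast]
  · rintro ⟨y, rfl⟩
    rw [vecVal, toList_ofList, List.map_ofFn]
    refine ⟨?_, by simp⟩
    congr 2
    funext l
    simp [fieldVal, Nat.mod_eq_of_lt (ZMod.val_lt (y l))]

/-- The heart of the proof. The inputs `x` enter only through the honest messages `h`. For every `h`
that can occur, the resulting view and the retained table are distributed as in the simulation,
because they depend on `h` only through the presence of messages, which is fixed beforehand. Thus
the average over `h` is one over a constant. -/
theorem Sim.round2_eq (x : {i : Fin P.n // i ∉ C} → Fin P.m → ZMod P.p) (K : Keys P.n)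
    (hK : Keys.Honest DS DH P C K) (S0 : State0 P.n) (S1 : State1 P.n P.p) (view : Value) :
    Sim.round2 DS AE M (publicVal DH P C aux) K.table (S0.table DH P) S1.table view =
      (AHSecAgg.round2 DS AE DH P M C x K S0 S1 view).map
        (Prod.map id (Option.map State2.table)) := by
  rw [Sim.round2, AHSecAgg.round2]
  simp only [pmf_bind_eq, PMF.map_bind, PMF.pure_bind]
  congr 1
  funext w
  symm
  -- From here on `h` is a fixed possible outcome; `PMF.bind_const` removes the average over it.
  refine (pmf_bind_congr_support fun h hh => ?_).trans (PMF.bind_const _ _)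
  -- Who sends is not random: it is decided by the checks, which the simulator can evaluate.
  have hsome : ∀ i, (h i).isSome =
      Sim.masks DS AE (publicVal DH P C aux) K.table (S0.table DH P) S1.table i := by
    intro i
    have h1 := mem_support_sampleAll hh i
    rw [Sim.masks_eq]
    split_ifs at h1 with hi
    · cases hs : S1.secret i with
      | none =>
        rw [hs] at h1
        rw [(PMF.mem_support_pure_iff _ _).1 h1]
        simp
      | some s =>
        rw [hs] at h1
        simp only [PMF.mem_support_bind_iff, PMF.mem_support_pure_iff] at h1
        obtain ⟨σ, -, h1⟩ := h1
        simp only [h1, Option.isSome_some]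
        exact (decide_eq_true ⟨hi, trivial⟩).symm
    · rw [(PMF.mem_support_pure_iff _ _).1 h1]
      simp only [Option.isSome_none]
      exact (decide_eq_false fun h2 => hi h2.1).symm
  -- Perfect correctness for honestly generated keys: an honest vector passes the format check and
  -- the signature check whatever the inputs and the mask are.
  have hval : ∀ i ∉ C, ∀ u, h i = some u → ∃ (y : Fin P.m → ZMod P.p) (σ : Value),
      u.2 = pair (vecVal y) σ ∧ DS.verify σ (K.pk i) (vecVal y) = true := by
    intro i hiC u hu
    have h1 := mem_support_sampleAll hh i
    rw [hu] at h1
    split_ifs at h1 with hi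
    · cases hs : S1.secret i with
      | none =>
        rw [hs] at h1
        simp at h1
      | some s =>
        rw [hs] at h1
        simp only [PMF.mem_support_bind_iff, PMF.mem_support_pure_iff] at h1
        obtain ⟨σ, hσ, h1⟩ := h1
        obtain rfl := Option.some.inj h1
        obtain ⟨key, hkey, hsk, hpk⟩ := hK i hiC
        rw [hsk] at hσ
        exact ⟨_, σ, rfl, hpk ▸ DS.correct _ _ hkey _ _ hσ⟩
    · simp at h1
  clear hh
  simp only [Sim.map_users]
  have hm : (fun i : Fin P.n => Sim.arrive (publicVal DH P C aux) w i
      (bif Sim.masks DS AE (publicVal DH P C aux) K.table (S0.table DH P) S1.table i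
        then some (atom 0) else none)) =
      sent C w fun i => (h i).map fun _ => atom 0 := by
    funext i
    rw [← Sim.arrive_publicVal DH P C aux w i fun i => (h i).map fun _ => atom 0, ← hsome]
    cases h i <;> rfl
  rw [hm]
  -- The tables with placeholders and with true messages have the same senders and agree on
  -- malicious users; honest entries are valid. The server's answer depends on nothing else.
  have hiso : ∀ i, (sent C w (fun i => (h i).map fun _ => atom 0) i).isSome =
      (sent C w (fun i => (h i).map Prod.snd) i).isSome := by
    intro i
    simp only [sent]
    split_ifs <;> simp
  have hC : ∀ i ∈ C, sent C w (fun i => (h i).map fun _ => atom 0) i =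
      sent C w (fun i => (h i).map Prod.snd) i := by
    intro i hi
    simp only [sent, if_pos hi]
  have hH : ∀ i ∉ C, ∀ u, sent C w (fun i => (h i).map Prod.snd) i = some u →
      ∃ (y : Fin P.m → ZMod P.p) (σ : Value),
        u = pair (vecVal y) σ ∧ DS.verify σ (K.pk i) (vecVal y) = true := by
    intro i hi u hu
    simp only [sent, if_neg hi] at hu
    split_ifs at hu
    obtain ⟨u', hu', rfl⟩ := Option.map_eq_some_iff.1 hu
    exact hval i hi u' hu'
  have htab : (List.ofFn fun i : Fin P.n => Sim.masks DS AE (publicVal DH P C aux) K.table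
      (S0.table DH P) S1.table i) = List.ofFn fun i => ((h i).map Prod.fst).isSome := by
    simp only [Option.isSome_map, hsome]
  rw [htab]
  generalize sent C w (fun i => (h i).map fun _ => atom 0) = msg' at *
  generalize sent C w (fun i => (h i).map Prod.snd) = msg at *
  simp only [Sim.contents_ofFn, at_ofFn]
  rw [show S1.table.1 = ids S1.U2 from rfl,
    Sim.accept_publicVal DH P C aux _ msg msg' _
      (fun _ v => ∃ (y : Fin P.m → ZMod P.p) (σ : Value), v = pair (vecVal y) σ) hiso
      fun i _ u hu => by
        rw [Sim.inC_publicVal]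
        by_cases hi : i ∈ C
        · rw [hC i hi, hu, Option.getD_some]
          cases u with
          | atom a => simp [hi, isAtomV]
          | pair a b => simp [hi, isAtomV, Sim.isVector_iff]
        · obtain ⟨y, σ, rfl, -⟩ := hH i hi u hu
          simp [hi]]
  have hcol : ∀ V, collect P.t S1.U2 msg
      (fun _ v => ∃ (y : Fin P.m → ZMod P.p) (σ : Value), v = pair (vecVal y) σ) = some V →
      ∀ i ∈ V, (msg i).isSome := by
    intro V hV i hi
    simp only [collect] at hV
    split_ifs at hV
    obtain rfl := Option.some.inj hV
    exact (Finset.mem_filter.1 hi).2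
  cases hV : collect P.t S1.U2 msg
      (fun _ v => ∃ (y : Fin P.m → ZMod P.p) (σ : Value), v = pair (vecVal y) σ) with
  | none => simp [PMF.pure_map]
  | some V =>
    -- For malicious users both filters verify the same message; for honest ones the true signature
    -- is valid, which matches the constant `true` of the simulator.
    have hU3 : ((ids V).filter fun i => bif Sim.inC (publicVal DH P C aux) i then
        DS.verify (Sim.at' (List.ofFn fun i => (msg' i).getD (atom 0)) i).snd
          (Sim.at' K.table.2.1 i)
          (Sim.at' (List.ofFn fun i => (msg' i).getD (atom 0)) i).fst
        else true) = ids (V.filter fun j => DS.verify ((msg j).getD (atom 0)).snd (K.pk j)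
          ((msg j).getD (atom 0)).fst = true) := by
      rw [filter_ids]
      congr 1
      refine Finset.filter_congr fun i hi => ?_
      rw [Sim.inC_publicVal, at_ofFn, Keys.table, at_ofFn]
      by_cases hiC : i ∈ C
      · rw [hC i hiC]
        simp [hiC]
      · obtain ⟨u, hu⟩ := Option.isSome_iff_exists.1 (hcol V hV i hi)
        obtain ⟨y, σ, rfl, hver⟩ := hH i hiC u hu
        simp [hiC, hu, hver]
    simp only [Option.map_some, Option.elim_some, PMF.map_bind, PMF.pure_map]
    rw [hU3]
    simp only [Sim.broadcast_publicVal, Sim.setCode_ids]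
    rfl

/-- Only signatures on `U3` are sent, so the simulator produces them itself. The whole state is then
forgotten, since round 4 sends nothing to the malicious users. -/
theorem Sim.round3_eq (K : Keys P.n) (S : State2 P.n P.m P.p) (view : Value) :
    Sim.round3 DS M (publicVal DH P C aux) K.table S.table view =
      (AHSecAgg.round3 DS DH P M C K S view).map
        (Prod.map id (Option.map fun _ => ())) := by
  rw [Sim.round3, AHSecAgg.round3]
  simp only [pmf_bind_eq, PMF.map_bind, Sim.mapP_users, PMF.bind_map, PMF.pure_bind]
  congr 1
  funext w
  refine congr_arg₂ PMF.bind ?_ (funext fun h => ?_)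
  · congr 1
    funext i
    rw [Sim.inC_publicVal]
    simp only [State2.table, Keys.table, memN_ids, getD_ofFn, at_ofFn, Sim.setCode_ids]
    by_cases hi : i ∉ C ∧ i ∈ S.U3 ∧ (S.held i).isSome ∧
        DS.verify S.σ4 K.pkS (setVal S.U3) = true
    · rw [if_pos hi]
      simp [hi]
    · rw [if_neg hi]
      have : (!decide (i ∈ C) && (decide (i ∈ S.U3) && ((S.held i).isSome &&
          DS.verify S.σ4 K.pkS (setVal S.U3)))) = false := by
        rw [← Bool.not_eq_true]
        simpa using hi
      rw [this]
      rfl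
  simp only [Function.comp_apply, Sim.map_users, getD_ofFn]
  have hm : (fun i : Fin P.n => Sim.arrive (publicVal DH P C aux) w i (h i)) = sent C w h := by
    funext i
    exact Sim.arrive_publicVal DH P C aux w i h
  rw [hm]
  generalize sent C w h = msg
  rw [Sim.contents_ofFn, show S.table.1 = ids S.U3 from rfl,
    Sim.accept_publicVal DH P C aux _ msg msg _ (fun _ _ => True) (fun _ => rfl)
      (fun _ _ _ _ => by simp)]
  cases collect P.t S.U3 msg (fun _ _ => True) with
  | none => simp [PMF.pure_map]
  | some U4 =>
    simp only [Option.map_some, Option.elim_some, PMF.pure_map, at_ofFn,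
      Sim.broadcast_publicVal, map_ids]
    rfl

/-- Whatever the honest users send and whether or not the server aborts, the view grows only by the
adversary's own output. -/
theorem Sim.round4_eq (K : Keys P.n) (S2 : State2 P.n P.m P.p) (S3 : State3 P.n) (view : Value) :
    (Sim.round4 M view).map Prod.fst =
      (AHSecAgg.round4 DS DH P M C K S2 S3 view).map Prod.fst := by
  rw [Sim.round4, AHSecAgg.round4]
  simp only [pmf_bind_eq, PMF.map_bind, PMF.map_comp]
  rw [PMF.map]
  congr 1
  funext w
  symm
  refine (pmf_bind_congr_support fun h _ => ?_).trans (PMF.bind_const _ _)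
  split
  · exact PMF.pure_map _ _
  · split_ifs <;> exact PMF.pure_map _ _

/-- The induction step over the rounds, with `e` forgetting part of the real state. If the server
aborts, both executions stop with the same view. Otherwise the continuations are compared only at
states that can occur, so that facts like `Keys.Honest` are available. -/
theorem thenRound_map_fst {α α' β β' : Type} {a : PMF (Value × Option α)}
    {a' : PMF (Value × Option α')} {e : α → α'} {f : Value → α → PMF (Value × Option β)}
    {f' : Value → α' → PMF (Value × Option β')}
    (ha : a' = a.map (Prod.map id (Option.map e)))
    (hf : ∀ v s, (v, some s) ∈ a.support → (f' v (e s)).map Prod.fst = (f v s).map Prod.fst) :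
    (thenRound a' f').map Prod.fst = (thenRound a f).map Prod.fst := by
  rw [ha, thenRound, thenRound, PMF.bind_map, PMF.map_bind, PMF.map_bind]
  refine pmf_bind_congr_support fun b hb => ?_
  rcases b with ⟨v, _ | s⟩
  · change (PMF.pure (v, none)).map Prod.fst = (PMF.pure (v, none)).map Prod.fst
    rw [PMF.pure_map, PMF.pure_map]
  · exact hf v s hb

theorem Sim.simulate_eq (x : {i : Fin P.n // i ∉ C} → Fin P.m → ZMod P.p) :
    Sim.simulate DS AE DH M (publicVal DH P C aux) = REAL DS AE DH P M C aux x := by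
  refine thenRound_map_fst (Sim.registration_eq DS DH P M C aux) fun v K hK => ?_
  refine thenRound_map_fst (Sim.round0_eq DS DH P M C aux K v) fun v S0 _ => ?_
  refine thenRound_map_fst (Sim.round1_eq DS AE DH P M C aux K S0 v) fun v S1 _ => ?_
  refine thenRound_map_fst (Sim.round2_eq DS AE DH P M C aux x K
    (honest_of_mem_support_registration DS DH P M C aux hK) S0 S1 v) fun v S2 _ => ?_
  refine thenRound_map_fst (Sim.round3_eq DS DH P M C aux K S2 v) fun v S3 _ => ?_
  exact Sim.round4_eq DS DH P M C K S2 S3 v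

end

end AHSecAgg

theorem theorem6p3 (DS : AHSecAgg.SignatureScheme) (AE : AHSecAgg.AEScheme)
    (DH : AHSecAgg.GroupFamily) (M : AHSecAgg.Prog) (hM : M.PPT) :
    ∃ SIM : AHSecAgg.Prog, SIM.PPT ∧
      ∀ (P : AHSecAgg.Params DH) (C : Finset (Fin P.n)), C.card < P.t →
        ∀ (aux : AHSecAgg.Value) (x : {i : Fin P.n // i ∉ C} → Fin P.m → ZMod P.p),
          SIM.out (AHSecAgg.publicVal DH P C aux) =
            AHSecAgg.REAL DS AE DH P M C aux x := by
  obtain ⟨SIM, hSIM, h⟩ := (AHSecAgg.Sim.pt_simulate DS AE DH M hM).exists_prog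
  exact ⟨SIM, hSIM, fun P C _ aux x =>
    (h _).trans (AHSecAgg.Sim.simulate_eq DS AE DH P M C aux x)⟩
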